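/- Let $m\ge 1$, $g\ge 0$, $n\ge 1$ be integers with $2g-2+n>0$, and consider the plane curve $x=z+1/z$, $y=z^m/m$ on $\mathbb{P}^1$, with branch points $z=\pm1$ of $x$ and involution $\hat z=1/z$. Let $\omega^g_n(z_1,\dots,z_n)$ be its Eynard–Orantin invariants: $\omega^0_1=y\,dx$, $\omega^0_2(w,z)=B(w,z)=\frac{dw\,dz}{(w-z)^2}$, and for $2g-2+(k+1)>0$, with $S=\{1,\dots,k\}$, \[\omega^g_{k+1}(z_0,z_S)=\sum_{\alpha=\pm1}\operatorname*{Res}_{z=\alpha}K(z_0,z)\Big[\omega^{g-1}_{k+2}(z,\hat z,z_S)+\sum_{g_1+g_2=g,\ I\sqcup J=S}\omega^{g_1}_{|I|+1}(z,z_I)\,\omega^{g_2}_{|J|+1}(\hat z,z_J)\Big],\] \[K(z_0,z)=\frac{-\int_{\hat z}^{z}B(z_0,z')}{2\,(y(z)-y(\hat z))\,dx(z)},\] where the first term in the bracket is absent if $g=0$ and the sum omits the terms containing a factor $\omega^0_1$, that is, those with $(g_1,I)=(0,\emptyset)$ or $(g_2,J)=(0,\emptyset)$. Then $\omega^g_n$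 has a unique expansion \[\omega^g_n(z_1,\dots,z_n)=\sum_{b_1,\dots,b_n>0}N^g_n(b_1,\dots,b_n)\prod_{i=1}^n b_i z_i^{b_i-1}\,dz_1\cdots dz_n\] in a neighbourhood of $(z_1,\dots,z_n)=(0,\dots,0)$, and its coefficients satisfy \[N^g_n(m,\underbrace{1,\dots,1}_{n-1})=0 .\] -/

import Mathlib

open scoped Topology

noncomputable section

namespace EynardOrantin

/-- The residue at `α` of `f(z) dz`: the limit of `(2πi)⁻¹ ∮_{|z - α| = r} f(z) dz` as `r → 0⁺`.
For `f` holomorphic in a punctured neighbourhood of `α` the integral is constant for small `r`. -/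
def residue (f : ℂ → ℂ) (α : ℂ) : ℂ :=
  Filter.limUnder (𝓝[>] (0 : ℝ))
    (fun r => (2 * (Real.pi : ℂ) * Complex.I)⁻¹ * ∮ z in C(α, r), f z)

/-- The two-to-one map `x(z) = z + 1/z`, with branch points `z = 1` and `z = -1`. -/
def curveX (z : ℂ) : ℂ := z + 1 / z

/-- The local involution `z ↦ ẑ` near `z = ±1`, with `x(ẑ) = x(z)`. -/
def hat (z : ℂ) : ℂ := 1 / z

/-- The density of the Bergmann kernel of `ℙ¹`, `B(w, z) = dw dz / (w - z)²`. -/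
def bergmann (w z : ℂ) : ℂ := 1 / (w - z) ^ 2

/-- The integral `∫_a^b B(w, z')` (in `z'`) over any path from `a` to `b` that avoids `w`; it is
a density in `w`. The primitive used here is the one of `hasDerivAt_bergmann_primitive`. -/
def bergmannIntegral (w a b : ℂ) : ℂ := 1 / (w - b) - 1 / (w - a)

theorem hasDerivAt_bergmann_primitive (w z : ℂ) (h : w ≠ z) :
    HasDerivAt (fun z' => 1 / (w - z')) (bergmann w z) z := by
  have h1 : HasDerivAt (fun z' : ℂ => w - z') (-1) z := by
    simpa using (hasDerivAt_id z).const_sub w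
  have h2 := h1.fun_inv (sub_ne_zero.mpr h)
  simpa [bergmann] using h2

/-- The recursion kernel
`K(z₀, z) = - ∫_{ẑ}^z B(z₀, ·) / (2 (y(z) - y(ẑ)) dx(z))`, written in the coordinate `z`. -/
def kernel (y : ℂ → ℂ) (z₀ z : ℂ) : ℂ :=
  -bergmannIntegral z₀ (hat z) z / (2 * (y z - y (hat z)) * deriv curveX z)

/-- The Eynard-Orantin invariants of the curve `x = z + 1/z`, `y = y(z)`.
`eoDensity y g n z₀ zS` is the density of `ω^g_{n+1}(z₀, z_1, …, z_n)` with respect to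
`dz₀ dz_1 ⋯ dz_n`.  The factor `deriv hat z` is `dẑ/dz`; the sum over `I ⊔ J = {1, …, n}`,
`g₁ + g₂ = g` omits the terms in which one of the factors is `ω^0_1`. -/
def eoDensity (y : ℂ → ℂ) : (g n : ℕ) → ℂ → (Fin n → ℂ) → ℂ
  | 0, 0, z₀, _ => y z₀ * deriv curveX z₀
  | 0, 1, z₀, zS => bergmann z₀ (zS 0)
  | g, n, z₀, zS =>
    ∑ α ∈ ({1, -1} : Finset ℂ), residue (fun z =>
      kernel y z₀ z *
        ((if _hg : 0 < g then eoDensity y (g - 1) (n + 1) z (Fin.cons (hat z) zS) else 0) +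
          ∑ g₁ : Fin (g + 1), ∑ I : Finset (Fin n),
            if _h : ¬ ((g₁ : ℕ) = 0 ∧ I.card = 0) ∧ ¬ (g - (g₁ : ℕ) = 0 ∧ Iᶜ.card = 0) then
              eoDensity y g₁ I.card z (fun i => zS (I.orderEmbOfFin rfl i)) *
                eoDensity y (g - g₁) Iᶜ.card (hat z) (fun i => zS (Iᶜ.orderEmbOfFin rfl i))
            else 0) *
        deriv hat z) α
termination_by g n => 2 * g + n
decreasing_by
  all_goals
    try have hc := Finset.card_add_card_compl I
    try simp only [Fintype.card_fin] at hc
    try have hlt := g₁.isLt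
    omega

/-- `N` is the family of coefficients of the expansion around `z = 0`
`ω = d/dz_1 ⋯ d/dz_k ∑_{b_i > 0} N(b_1, …, b_k) z_1^{b_1} ⋯ z_k^{b_k}`, differentiated
term by term. -/
def IsExpansion {k : ℕ} (ω : (Fin k → ℂ) → ℂ) (N : (Fin k → ℕ+) → ℂ) : Prop :=
  ∀ᶠ z in 𝓝 (0 : Fin k → ℂ),
    HasSum (fun b : Fin k → ℕ+ => N b * ∏ i, ((b i : ℕ) : ℂ) * z i ^ ((b i : ℕ) - 1)) (ω z)

/-- `IsN y g n N` says that `N` is the family `N^g_{n+1}(b_0, …, b_n)`, `b_i > 0`, attached to the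
curve `x = z + 1/z`, `y = y(z)`. -/
def IsN (y : ℂ → ℂ) (g n : ℕ) (N : (Fin (n + 1) → ℕ+) → ℂ) : Prop :=
  IsExpansion (fun z : Fin (n + 1) → ℂ => eoDensity y g n (z 0) (Fin.tail z)) N

end EynardOrantin

end

noncomputable section

namespace EynardOrantin

open Filter Metric

/-! ### Residues of meromorphic functions -/

theorem residue_eq_circleIntegral {f : ℂ → ℂ} {α : ℂ} {R : ℝ} (hR : 0 < R)
    (hf : ∀ z ∈ closedBall α R \ {α}, DifferentiableAt ℂ f z) :
    residue f α = (2 * (Real.pi : ℂ) * Complex.I)⁻¹ * ∮ z in C(α, R), f z := by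
  have key : ∀ᶠ r in 𝓝[>] (0 : ℝ), (2 * (Real.pi : ℂ) * Complex.I)⁻¹ * (∮ z in C(α, R), f z) =
      (2 * (Real.pi : ℂ) * Complex.I)⁻¹ * ∮ z in C(α, r), f z := by
    filter_upwards [Ioc_mem_nhdsGT hR] with r hr
    have hsub : closedBall α R \ ball α r ⊆ closedBall α R \ {α} := by
      intro z hz
      refine ⟨hz.1, ?_⟩
      rintro rfl
      exact hz.2 (mem_ball_self hr.1)
    congr 1
    refine Complex.circleIntegral_eq_of_differentiable_on_annulus_off_countable hr.1 hr.2
      Set.countable_empty (fun z hz => (hf z (hsub hz)).continuousAt.continuousWithinAt) ?_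
    intro z hz
    exact hf z (hsub ⟨ball_subset_closedBall hz.1.1, fun h => hz.1.2 (ball_subset_closedBall h)⟩)
  exact (tendsto_const_nhds.congr' key).limUnder_eq

theorem eventually_forall_punctured_closedBall {p : ℂ → Prop} {α : ℂ} (h : ∀ᶠ z in 𝓝[≠] α, p z) :
    ∀ᶠ R in 𝓝[>] (0 : ℝ), ∀ z ∈ closedBall α R \ {α}, p z := by
  obtain ⟨ε, hε, hb⟩ := Metric.mem_nhdsWithin_iff.1 h
  filter_upwards [Ioo_mem_nhdsGT hε] with R hR z hz
  exact hb ⟨closedBall_subset_ball hR.2 hz.1, hz.2⟩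

theorem sphere_subset_punctured {α : ℂ} {R : ℝ} (hR : 0 < R) :
    sphere α R ⊆ closedBall α R \ {α} := by
  intro z hz
  refine ⟨sphere_subset_closedBall hz, ?_⟩
  rintro rfl
  simp [hR.ne] at hz

theorem residue_congr {f g : ℂ → ℂ} {α : ℂ} (h : ∀ᶠ z in 𝓝[≠] α, f z = g z) :
    residue f α = residue g α := by
  unfold residue limUnder
  congr 1
  refine Filter.map_congr ?_
  filter_upwards [eventually_forall_punctured_closedBall h, self_mem_nhdsWithin] with R hR h0
  congr 1
  exact circleIntegral.integral_congr (le_of_lt h0) fun z hz => hR z (sphere_subset_punctured h0 hz)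

theorem _root_.MeromorphicAt.eventually_differentiableAt {f : ℂ → ℂ} {α : ℂ}
    (hf : MeromorphicAt f α) : ∀ᶠ z in 𝓝[≠] α, DifferentiableAt ℂ f z :=
  hf.eventually_analyticAt.mono fun _ h => h.differentiableAt

theorem exists_punctured_closedBall {p : ℂ → Prop} {α : ℂ}
    (h : ∀ᶠ z in 𝓝[≠] α, p z) {ε : ℝ} (hε : 0 < ε) :
    ∃ R, 0 < R ∧ R < ε ∧ ∀ z ∈ closedBall α R \ {α}, p z := by
  have := (eventually_forall_punctured_closedBall h).and (Ioo_mem_nhdsGT hε)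
  obtain ⟨R, h1, h2⟩ := this.exists
  exact ⟨R, h2.1, h2.2, h1⟩

theorem circleIntegrable_of_punctured {f : ℂ → ℂ} {α : ℂ} {R : ℝ} (hR : 0 < R)
    (hf : ∀ z ∈ closedBall α R \ {α}, DifferentiableAt ℂ f z) : CircleIntegrable f α R :=
  ContinuousOn.circleIntegrable hR.le fun z hz =>
    (hf z (sphere_subset_punctured hR hz)).continuousAt.continuousWithinAt

theorem residue_add {f g : ℂ → ℂ} {α : ℂ} (hf : MeromorphicAt f α) (hg : MeromorphicAt g α) :
    residue (fun z => f z + g z) α = residue f α + residue g α := by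
  obtain ⟨R, hR, -, h⟩ := exists_punctured_closedBall
    (hf.eventually_differentiableAt.and hg.eventually_differentiableAt) one_pos
  have hf' := fun z hz => (h z hz).1
  have hg' := fun z hz => (h z hz).2
  rw [residue_eq_circleIntegral hR hf', residue_eq_circleIntegral hR hg',
    residue_eq_circleIntegral hR fun z hz => (hf' z hz).fun_add (hg' z hz),
    circleIntegral.integral_add (circleIntegrable_of_punctured hR hf')
      (circleIntegrable_of_punctured hR hg'), mul_add]

theorem residue_const_mul (c : ℂ) {f : ℂ → ℂ} {α : ℂ} (hf : MeromorphicAt f α) :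
    residue (fun z => c * f z) α = c * residue f α := by
  obtain ⟨R, hR, -, h⟩ := exists_punctured_closedBall hf.eventually_differentiableAt one_pos
  rw [residue_eq_circleIntegral hR h,
    residue_eq_circleIntegral hR fun z hz => (h z hz).const_mul c,
    circleIntegral.integral_const_mul]
  ring

theorem residue_eq_zero {f g : ℂ → ℂ} {α : ℂ} (hg : AnalyticAt ℂ g α)
    (h : ∀ᶠ z in 𝓝[≠] α, f z = g z) : residue f α = 0 := by
  rw [residue_congr h]
  obtain ⟨R, hR, -, h⟩ := exists_punctured_closedBall
    (hg.eventually_analyticAt.filter_mono nhdsWithin_le_nhds) one_pos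
  have h' : ∀ z ∈ closedBall α R, DifferentiableAt ℂ g z := by
    intro z hz
    by_cases hz' : z = α
    · exact hz' ▸ hg.differentiableAt
    · exact (h z ⟨hz, hz'⟩).differentiableAt
  rw [residue_eq_circleIntegral hR fun z hz => h' z hz.1,
    Complex.circleIntegral_eq_zero_of_differentiable_on_off_countable hR.le Set.countable_empty
      (fun z hz => (h' z hz).continuousAt.continuousWithinAt)
      (fun z hz => h' z (ball_subset_closedBall hz.1)), mul_zero]

theorem residue_sum {ι : Type*} (s : Finset ι) {f : ι → ℂ → ℂ} {α : ℂ}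
    (hf : ∀ i ∈ s, MeromorphicAt (f i) α) :
    residue (fun z => ∑ i ∈ s, f i z) α = ∑ i ∈ s, residue (f i) α := by
  classical
  induction s using Finset.induction_on with
  | empty => simpa using residue_eq_zero (f := fun _ => 0) (analyticAt_const (v := (0 : ℂ))) (by simp)
  | insert a s ha ih =>
    simp only [Finset.sum_insert ha]
    rw [residue_add (hf a (by simp)) (MeromorphicAt.fun_sum fun i hi => hf i (by simp [hi])),
      ih fun i hi => hf i (by simp [hi])]

theorem residue_inv_sub_pow (α : ℂ) (k : ℕ) (hk : k ≠ 1) :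
    residue (fun z => ((z - α) ^ k)⁻¹) α = 0 := by
  rw [residue_eq_circleIntegral one_pos]
  · have := circleIntegral.integral_sub_zpow_of_ne (n := -(k : ℤ)) (by omega) α α 1
    simp only [zpow_neg, zpow_natCast] at this
    rw [this, mul_zero]
  · intro z hz
    have : z - α ≠ 0 := sub_ne_zero.2 hz.2
    exact ((differentiableAt_id.sub_const α).pow k).inv (pow_ne_zero _ this)

theorem residue_inv_sub (α : ℂ) : residue (fun z => (z - α)⁻¹) α = 1 := by
  rw [residue_eq_circleIntegral one_pos]
  · rw [circleIntegral.integral_sub_center_inv α one_ne_zero]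
    exact inv_mul_cancel₀ Complex.two_pi_I_ne_zero
  · intro z hz
    exact (differentiableAt_id.sub_const α).inv (sub_ne_zero.2 hz.2)

/-- The sum of the residues at the two branch points `1` and `-1`. -/
def branchResidue (f : ℂ → ℂ) : ℂ := ∑ α ∈ ({1, -1} : Finset ℂ), residue f α

theorem branchResidue_eq (f : ℂ → ℂ) : branchResidue f = residue f 1 + residue f (-1) := by
  rw [branchResidue, Finset.sum_pair (by norm_num)]

theorem branchResidue_congr {f g : ℂ → ℂ} (h : ∀ z, z ≠ 0 → z ≠ 1 → z ≠ -1 → f z = g z) :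
    branchResidue f = branchResidue g := by
  have aux : ∀ α : ℂ, α ≠ 0 → ∀ᶠ z in 𝓝[≠] α, z ≠ 0 := fun α hα =>
    (isOpen_ne.mem_nhds hα : {z : ℂ | z ≠ 0} ∈ 𝓝 α) |> mem_nhdsWithin_of_mem_nhds
  have h2 : (1 : ℂ) ≠ -1 := by norm_num
  rw [branchResidue_eq, branchResidue_eq]
  congr 1 <;> refine residue_congr ?_
  · filter_upwards [aux 1 one_ne_zero, self_mem_nhdsWithin,
      mem_nhdsWithin_of_mem_nhds (isOpen_ne.mem_nhds h2)] with z h0 h1 h3 using h z h0 h1 h3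
  · filter_upwards [aux (-1) (by norm_num), self_mem_nhdsWithin,
      mem_nhdsWithin_of_mem_nhds (isOpen_ne.mem_nhds h2.symm)] with z h0 h1 h3 using h z h0 h3 h1

theorem add_mem_span_of_forall_add_mem {M : Type*} [AddCommGroup M] [Module ℂ M] {S : Set M}
    {f d : M} (hS : S.Nonempty) (h : ∀ s ∈ S, s + d ∈ S) (hf : f ∈ Submodule.span ℂ S) :
    f + d ∈ Submodule.span ℂ S := by
  obtain ⟨s, hs⟩ := hS
  have : f + d = f + ((s + d) - s) := by abel
  rw [this]
  exact add_mem hf (sub_mem (Submodule.subset_span (h s hs)) (Submodule.subset_span hs))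

/-! ### Rational functions with vanishing sum of residues at the branch points -/

theorem branchResidue_add {f g : ℂ → ℂ} (hf : MeromorphicAt f 1 ∧ MeromorphicAt f (-1))
    (hg : MeromorphicAt g 1 ∧ MeromorphicAt g (-1)) :
    branchResidue (fun z => f z + g z) = branchResidue f + branchResidue g := by
  simp only [branchResidue_eq, residue_add hf.1 hg.1, residue_add hf.2 hg.2]
  ring

theorem branchResidue_const_mul (c : ℂ) {f : ℂ → ℂ}
    (hf : MeromorphicAt f 1 ∧ MeromorphicAt f (-1)) :
    branchResidue (fun z => c * f z) = c * branchResidue f := by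
  simp only [branchResidue_eq, residue_const_mul c hf.1, residue_const_mul c hf.2]
  ring

/-- The rational function `z ^ l / ((z - 1) ^ a (z + 1) ^ b)`. -/
def branchMonomial (l a b : ℕ) (z : ℂ) : ℂ := z ^ l * ((z - 1) ^ a)⁻¹ * ((z + 1) ^ b)⁻¹

theorem meromorphicAt_branchMonomial (l a b : ℕ) (α : ℂ) :
    MeromorphicAt (branchMonomial l a b) α := by
  unfold branchMonomial
  fun_prop

theorem branchResidue_branchMonomial_combination {l a b l₁ a₁ b₁ l₂ a₂ b₂ : ℕ} (c₁ c₂ : ℂ)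
    (h₁ : branchResidue (branchMonomial l₁ a₁ b₁) = 0)
    (h₂ : branchResidue (branchMonomial l₂ a₂ b₂) = 0)
    (h : ∀ z : ℂ, z - 1 ≠ 0 → z + 1 ≠ 0 → branchMonomial l a b z =
      c₁ * branchMonomial l₁ a₁ b₁ z + c₂ * branchMonomial l₂ a₂ b₂ z) :
    branchResidue (branchMonomial l a b) = 0 := by
  have hm := fun l a b (α : ℂ) => meromorphicAt_branchMonomial l a b α
  have hc : ∀ c l a b (α : ℂ), MeromorphicAt (fun z => c * branchMonomial l a b z) α :=
    fun c l a b α => (MeromorphicAt.const c α).mul (hm l a b α)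
  rw [branchResidue_congr fun z _ hz₁ hz₂ => h z (sub_ne_zero.2 hz₁)
    (fun h => hz₂ (eq_neg_of_add_eq_zero_left h)),
    branchResidue_add ⟨hc _ _ _ _ _, hc _ _ _ _ _⟩ ⟨hc _ _ _ _ _, hc _ _ _ _ _⟩,
    branchResidue_const_mul _ ⟨hm _ _ _ _, hm _ _ _ _⟩,
    branchResidue_const_mul _ ⟨hm _ _ _ _, hm _ _ _ _⟩, h₁, h₂]
  ring

theorem branchResidue_branchMonomial_one_one : branchResidue (branchMonomial 0 1 1) = 0 := by
  have e : ∀ z : ℂ, z ≠ 0 → z ≠ 1 → z ≠ -1 →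
      branchMonomial 0 1 1 z = 2⁻¹ * (z - 1)⁻¹ + -2⁻¹ * (z - (-1))⁻¹ := by
    intro z _ h1 h2
    have h1 : z - 1 ≠ 0 := sub_ne_zero.2 h1
    have h2 : z + 1 ≠ 0 := fun h => h2 (eq_neg_of_add_eq_zero_left h)
    simp only [branchMonomial, sub_neg_eq_add]
    field_simp
    ring
  have hm : ∀ β α : ℂ, MeromorphicAt (fun z => (z - β)⁻¹) α := fun β α => by fun_prop
  have hm' : ∀ c β α : ℂ, MeromorphicAt (fun z => c * (z - β)⁻¹) α := fun c β α => by fun_prop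
  have h0 : ∀ α β : ℂ, α ≠ β → residue (fun z => (z - β)⁻¹) α = 0 := by
    intro α β h
    refine residue_eq_zero (g := fun z => (z - β)⁻¹) ?_ (by simp)
    exact (analyticAt_id.sub analyticAt_const).inv (sub_ne_zero.2 h)
  rw [branchResidue_congr e, branchResidue_add ⟨hm' _ _ _, hm' _ _ _⟩ ⟨hm' _ _ _, hm' _ _ _⟩,
    branchResidue_const_mul _ ⟨hm _ _, hm _ _⟩, branchResidue_const_mul _ ⟨hm _ _, hm _ _⟩,
    branchResidue_eq, branchResidue_eq, residue_inv_sub, residue_inv_sub, h0 1 (-1) (by norm_num),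
    h0 (-1) 1 (by norm_num)]
  ring

theorem branchResidue_branchMonomial_left {a : ℕ} (ha : a ≠ 1) :
    branchResidue (branchMonomial 0 a 0) = 0 := by
  have : branchMonomial 0 a 0 = fun z => ((z - 1) ^ a)⁻¹ := by ext; simp [branchMonomial]
  rw [this, branchResidue_eq, residue_inv_sub_pow 1 a ha, zero_add]
  refine residue_eq_zero (g := fun z => ((z - 1) ^ a)⁻¹) ?_ (by simp)
  exact ((analyticAt_id.sub analyticAt_const).pow a).inv (pow_ne_zero _ (by norm_num))

theorem branchResidue_branchMonomial_right {b : ℕ} (hb : b ≠ 1) :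
    branchResidue (branchMonomial 0 0 b) = 0 := by
  have : branchMonomial 0 0 b = fun z => ((z - (-1)) ^ b)⁻¹ := by ext; simp [branchMonomial]
  rw [this, branchResidue_eq, residue_inv_sub_pow (-1) b hb, add_zero]
  refine residue_eq_zero (g := fun z => ((z - (-1)) ^ b)⁻¹) ?_ (by simp)
  exact ((analyticAt_id.sub analyticAt_const).pow b).inv (pow_ne_zero _ (by norm_num))

theorem branchResidue_branchMonomial (l a b : ℕ) (h : l + 2 ≤ a + b) :
    branchResidue (branchMonomial l a b) = 0 := by
  induction hN : l + a + b using Nat.strong_induction_on generalizing l a b with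
  | _ N ih =>
  have hm : ∀ l' a' b', l' + 2 ≤ a' + b' → l' + a' + b' < N →
    branchResidue (branchMonomial l' a' b') = 0 := fun l' a' b' h1 h2 => ih _ h2 l' a' b' h1 rfl
  rcases l with _ | l
  · rcases a with _ | a
    · exact branchResidue_branchMonomial_right (by omega)
    rcases b with _ | b
    · exact branchResidue_branchMonomial_left (by omega)
    by_cases hab : a = 0 ∧ b = 0
    · rw [hab.1, hab.2]
      exact branchResidue_branchMonomial_one_one
    refine branchResidue_branchMonomial_combination 2⁻¹ (-2⁻¹) (hm 0 (a + 1) b (by omega) (by omega))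
      (hm 0 a (b + 1) (by omega) (by omega)) fun z h1 h2 => ?_
    simp only [branchMonomial]
    field_simp
    ring
  · rcases a with _ | a
    · rcases b with _ | b
      · omega
      refine branchResidue_branchMonomial_combination 1 (-1) (hm l 0 b (by omega) (by omega))
        (hm l 0 (b + 1) (by omega) (by omega)) fun z h1 h2 => ?_
      simp only [branchMonomial]
      field_simp
      ring
    · refine branchResidue_branchMonomial_combination 1 1 (hm l a b (by omega) (by omega))
        (hm l (a + 1) b (by omega) (by omega)) fun z h1 h2 => ?_
      simp only [branchMonomial]
      field_simp
      ring

/-- The space of functions that agree away from `0`, `1`, `-1` with a linear combination of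
rational functions whose poles are at `±1` and which vanish to second order at infinity. -/
def balanced : Submodule ℂ (ℂ → ℂ) :=
  Submodule.span ℂ {f | ∃ l a b : ℕ, l + 2 ≤ a + b ∧
    ∀ z, z ≠ 0 → z ≠ 1 → z ≠ -1 → f z = branchMonomial l a b z}

theorem balanced_of_eq {f : ℂ → ℂ} {l a b : ℕ} (h : l + 2 ≤ a + b)
    (hf : ∀ z, z ≠ 0 → z ≠ 1 → z ≠ -1 → f z = branchMonomial l a b z) : f ∈ balanced :=
  Submodule.subset_span ⟨l, a, b, h, hf⟩

theorem balanced_congr {f g : ℂ → ℂ} (hf : f ∈ balanced)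
    (h : ∀ z, z ≠ 0 → z ≠ 1 → z ≠ -1 → g z = f z) : g ∈ balanced := by
  have : g = f + (g - f) := by abel
  rw [this]
  refine add_mem_span_of_forall_add_mem ⟨branchMonomial 0 2 0, 0, 2, 0, le_rfl, by simp⟩ ?_ hf
  rintro s ⟨l, a, b, hl, hs⟩
  refine ⟨l, a, b, hl, fun z h0 h1 h2 => ?_⟩
  simp [h z h0 h1 h2, hs z h0 h1 h2]

theorem eventually_punctured_branch (α : ℂ) :
    ∀ᶠ z in 𝓝[≠] α, z ≠ 0 ∧ z ≠ 1 ∧ z ≠ -1 := by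
  have h : ∀ β : ℂ, ∀ᶠ z in 𝓝[≠] α, z ≠ β := by
    intro β
    by_cases h : β = α
    · exact h ▸ self_mem_nhdsWithin
    · exact mem_nhdsWithin_of_mem_nhds (isOpen_ne.mem_nhds (Ne.symm h))
  exact (h 0).and ((h 1).and (h (-1)))

theorem meromorphicAt_of_mem_balanced {f : ℂ → ℂ} (hf : f ∈ balanced) (α : ℂ) :
    MeromorphicAt f α := by
  induction hf using Submodule.span_induction with
  | mem f hf =>
    obtain ⟨l, a, b, -, h⟩ := hf
    refine (meromorphicAt_branchMonomial l a b α).congr ?_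
    filter_upwards [eventually_punctured_branch α] with z hz using (h z hz.1 hz.2.1 hz.2.2).symm
  | zero => exact MeromorphicAt.const 0 α
  | add f g _ _ hf hg => exact hf.add hg
  | smul c f _ hf => exact hf.const_smul c

theorem branchResidue_of_mem_balanced {f : ℂ → ℂ} (hf : f ∈ balanced) : branchResidue f = 0 := by
  induction hf using Submodule.span_induction with
  | mem f hf =>
    obtain ⟨l, a, b, hl, h⟩ := hf
    rw [branchResidue_congr h, branchResidue_branchMonomial l a b hl]
  | zero =>
    have : branchResidue (fun z => 0 * branchMonomial 0 0 0 z) = 0 := by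
      rw [branchResidue_const_mul _ ⟨meromorphicAt_branchMonomial _ _ _ _,
        meromorphicAt_branchMonomial _ _ _ _⟩, zero_mul]
    simp only [zero_mul] at this
    exact this
  | add f g hf hg ihf ihg =>
    have := branchResidue_add
      ⟨meromorphicAt_of_mem_balanced hf _, meromorphicAt_of_mem_balanced hf _⟩
      ⟨meromorphicAt_of_mem_balanced hg _, meromorphicAt_of_mem_balanced hg _⟩
    rw [ihf, ihg, add_zero] at this
    exact this
  | smul c f hf ihf =>
    have := branchResidue_const_mul c
      ⟨meromorphicAt_of_mem_balanced hf _, meromorphicAt_of_mem_balanced hf _⟩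
    rw [ihf, mul_zero] at this
    exact this

/-! ### Principal parts without residue -/

/-- The span of the functions `w ↦ (w - α) ^ (-(k + 2))`, where `α = ±1` is a branch point. -/
def polarParts : Submodule ℂ (ℂ → ℂ) :=
  Submodule.span ℂ {φ | ∃ α : ℂ, (α = 1 ∨ α = -1) ∧ ∃ k : ℕ, φ = fun w => ((w - α) ^ (k + 2))⁻¹}

theorem mem_polarParts {α : ℂ} (hα : α = 1 ∨ α = -1) {k : ℕ} (hk : 2 ≤ k) :
    (fun w => ((w - α) ^ k)⁻¹) ∈ polarParts := by
  obtain ⟨k, rfl⟩ := Nat.exists_eq_add_of_le' hk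
  exact Submodule.subset_span ⟨α, hα, k, rfl⟩

/-- The span of `polarParts` and `w ↦ w⁻²`, the density `B(w, 0)`. -/
def extendedPolarParts : Submodule ℂ (ℂ → ℂ) :=
  Submodule.span ℂ ({φ | ∃ α : ℂ, (α = 1 ∨ α = -1) ∧ ∃ k : ℕ, φ = fun w => ((w - α) ^ (k + 2))⁻¹} ∪
    {fun w => (w ^ 2)⁻¹})

theorem polarParts_le_extended : polarParts ≤ extendedPolarParts :=
  Submodule.span_mono Set.subset_union_left

theorem inv_sub_pow_eq {z α : ℂ} (hz : z ≠ 0) (hα : α = 1 ∨ α = -1) (k : ℕ) :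
    ((1 / z - α) ^ k)⁻¹ = (-α) ^ k * (z ^ k * ((z - α) ^ k)⁻¹) := by
  have h : (1 / z - α) = (-α)⁻¹ * (z⁻¹ * (z - α)) := by
    rcases hα with rfl | rfl <;> field_simp <;> ring
  rw [h, mul_pow, mul_pow, mul_inv, mul_inv, inv_pow, inv_pow, inv_inv, inv_inv]

theorem mul_hat_div_mem_balanced {f h : ℂ → ℂ} (hf : f ∈ extendedPolarParts)
    (hh : h ∈ extendedPolarParts) :
    (fun z => f z * h (hat z) * (z ^ 2 - 1)⁻¹) ∈ balanced := by
  refine Submodule.span_induction₂ (R := ℂ)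
    (p := fun f h _ _ => (fun z => f z * h (hat z) * (z ^ 2 - 1)⁻¹) ∈ balanced)
    ?_ ?_ ?_ ?_ ?_ ?_ ?_ hf hh
  · have hd : ∀ z : ℂ, (z ^ 2 - 1)⁻¹ = (z - 1)⁻¹ * (z + 1)⁻¹ := fun z => by
      rw [← mul_inv]; ring_nf
    have hs : ∀ (c : ℂ) (l a b : ℕ) (F : ℂ → ℂ), l + 2 ≤ a + b →
        (∀ z, z ≠ 0 → z ≠ 1 → z ≠ -1 → F z = c * branchMonomial l a b z) → F ∈ balanced := by
      intro c l a b F hl hF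
      exact balanced_congr (balanced.smul_mem c (balanced_of_eq hl fun _ _ _ _ => rfl)) hF
    rintro f h (⟨α, hα, k, rfl⟩ | rfl) (⟨β, hβ, j, rfl⟩ | rfl)
    · have key : ∀ z : ℂ, z ≠ 0 → ((z - α) ^ (k + 2))⁻¹ * ((hat z - β) ^ (j + 2))⁻¹ *
          (z ^ 2 - 1)⁻¹ = (-β) ^ (j + 2) * (z ^ (j + 2) * ((z - α) ^ (k + 2))⁻¹ *
            ((z - β) ^ (j + 2))⁻¹ * ((z - 1)⁻¹ * (z + 1)⁻¹)) := by
        intro z hz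
        rw [hat, inv_sub_pow_eq hz hβ, hd]
        ring
      rcases hα with rfl | rfl <;> rcases hβ with rfl | rfl
      · refine hs ((-1) ^ (j + 2)) (j + 2) (k + 2 + (j + 2) + 1) 1 _ (by omega) fun z hz h1 h2 => ?_
        rw [key z hz, branchMonomial, pow_add _ (k + 2 + (j + 2)) 1, pow_add _ (k + 2)]; simp only [mul_inv]; ring
      · refine hs ((-(-1)) ^ (j + 2)) (j + 2) (k + 2 + 1) (j + 2 + 1) _ (by omega) fun z hz h1 h2 => ?_
        rw [key z hz, branchMonomial, pow_add _ (k + 2) 1, pow_add _ (j + 2) 1]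
        simp only [mul_inv, sub_neg_eq_add]; ring
      · refine hs ((-1) ^ (j + 2)) (j + 2) (j + 2 + 1) (k + 2 + 1) _ (by omega) fun z hz h1 h2 => ?_
        rw [key z hz, branchMonomial, pow_add _ (k + 2) 1, pow_add _ (j + 2) 1]
        simp only [mul_inv, sub_neg_eq_add]; ring
      · refine hs ((-(-1)) ^ (j + 2)) (j + 2) 1 (k + 2 + (j + 2) + 1) _ (by omega) fun z hz h1 h2 => ?_
        rw [key z hz, branchMonomial, pow_add _ (k + 2 + (j + 2)) 1, pow_add _ (k + 2)]
        simp only [mul_inv, sub_neg_eq_add]; ring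
    · have key : ∀ z : ℂ, z ≠ 0 → ((z - α) ^ (k + 2))⁻¹ * ((hat z) ^ 2)⁻¹ *
          (z ^ 2 - 1)⁻¹ = 1 * (z ^ 2 * ((z - α) ^ (k + 2))⁻¹ * ((z - 1)⁻¹ * (z + 1)⁻¹)) := by
        intro z hz
        rw [hat, hd, one_div, inv_pow, inv_inv]
        ring
      rcases hα with rfl | rfl
      · refine hs 1 2 (k + 2 + 1) 1 _ (by omega) fun z hz h1 h2 => ?_
        rw [key z hz, branchMonomial, pow_add _ (k + 2) 1]; simp only [mul_inv]; ring
      · refine hs 1 2 1 (k + 2 + 1) _ (by omega) fun z hz h1 h2 => ?_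
        rw [key z hz, branchMonomial, pow_add _ (k + 2) 1]
        simp only [mul_inv, sub_neg_eq_add]; ring
    · have key : ∀ z : ℂ, z ≠ 0 → (z ^ 2)⁻¹ * ((hat z - β) ^ (j + 2))⁻¹ *
          (z ^ 2 - 1)⁻¹ = (-β) ^ (j + 2) * (z ^ j *
            ((z - β) ^ (j + 2))⁻¹ * ((z - 1)⁻¹ * (z + 1)⁻¹)) := by
        intro z hz
        rw [hat, inv_sub_pow_eq hz hβ, hd, pow_add z j 2]
        field_simp
      rcases hβ with rfl | rfl
      · refine hs ((-1) ^ (j + 2)) j (j + 2 + 1) 1 _ (by omega) fun z hz h1 h2 => ?_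
        rw [key z hz, branchMonomial, pow_add _ (j + 2) 1]; simp only [mul_inv]; ring
      · refine hs ((-(-1)) ^ (j + 2)) j 1 (j + 2 + 1) _ (by omega) fun z hz h1 h2 => ?_
        rw [key z hz, branchMonomial, pow_add _ (j + 2) 1]
        simp only [mul_inv, sub_neg_eq_add]; ring
    · refine hs 1 0 1 1 _ (by omega) fun z hz h1 h2 => ?_
      rw [hd, branchMonomial, hat]
      field_simp
  · intro h _
    exact balanced_congr balanced.zero_mem fun z _ _ _ => by simp
  · intro h _
    exact balanced_congr balanced.zero_mem fun z _ _ _ => by simp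
  · intro f f' h _ _ _ h1 h2
    exact balanced_congr (add_mem h1 h2) fun z _ _ _ => by simp [add_mul]
  · intro f h h' _ _ _ h1 h2
    exact balanced_congr (add_mem h1 h2) fun z _ _ _ => by simp [add_mul, mul_add]
  · intro c f h _ _ h1
    exact balanced_congr (balanced.smul_mem c h1) fun z _ _ _ => by simp [mul_assoc]
  · intro c f h _ _ h1
    exact balanced_congr (balanced.smul_mem c h1) fun z _ _ _ => by simp; ring

/-! ### Tensor products of principal parts -/

/-- A tuple of points none of which is a branch point. -/
def OffBranch {ι : Type*} (w : ι → ℂ) : Prop := ∀ i, w i ≠ 1 ∧ w i ≠ -1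

/-- The span of the products `∏ i ∈ s, φ i (w i)` of principal parts, as functions of the tuple
`w` away from the branch points. -/
def polarTensors {ι : Type*} (s : Finset ι) : Submodule ℂ ((ι → ℂ) → ℂ) :=
  Submodule.span ℂ {F | ∃ φ : ι → ℂ → ℂ, (∀ i, φ i ∈ polarParts) ∧
    ∀ w, OffBranch w → F w = ∏ i ∈ s, φ i (w i)}

theorem polarTensors_congr {ι : Type*} {s : Finset ι} {F G : (ι → ℂ) → ℂ} (hF : F ∈ polarTensors s)
    (h : ∀ w, OffBranch w → G w = F w) : G ∈ polarTensors s := by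
  have : G = F + (G - F) := by abel
  rw [this]
  refine add_mem_span_of_forall_add_mem
    ⟨fun _ => ∏ i ∈ s, 0, fun _ => 0, fun _ => polarParts.zero_mem, fun _ _ => rfl⟩ ?_ hF
  rintro G' ⟨φ, hφ, hG⟩
  exact ⟨φ, hφ, fun w hw => by simp [h w hw, hG w hw]⟩

theorem mul_mem_polarTensors {ι : Type*} [DecidableEq ι] {s : Finset ι} {a : ι} (ha : a ∉ s)
    {φ : ℂ → ℂ} (hφ : φ ∈ polarParts) {F : (ι → ℂ) → ℂ} (hF : F ∈ polarTensors s) :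
    (fun w => φ (w a) * F w) ∈ polarTensors (insert a s) := by
  induction hF using Submodule.span_induction with
  | mem F hF =>
    obtain ⟨χ, hχ, h⟩ := hF
    refine Submodule.subset_span ⟨Function.update χ a φ, fun i => ?_, fun w hw => ?_⟩
    · by_cases hi : i = a
      · subst hi; simpa using hφ
      · simpa [Function.update_of_ne hi] using hχ i
    · beta_reduce
      rw [Finset.prod_insert ha, Function.update_self, h w hw]
      congr 1
      refine Finset.prod_congr rfl fun i hi => ?_
      rw [Function.update_of_ne (ne_of_mem_of_not_mem hi ha)]
  | zero => exact polarTensors_congr (zero_mem _) fun w _ => by simp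
  | add F G _ _ hF hG => exact polarTensors_congr (add_mem hF hG) fun w _ => by simp [mul_add]
  | smul c F _ hF =>
    exact polarTensors_congr (Submodule.smul_mem _ c hF) fun w _ => by simp; ring

/-- A family `ψ z w` of functions of `z` analytic at `α` whose Taylor coefficients at `α` are
principal parts in `w`, in the sense of expansions up to order `(z - α) ^ p` for every `p`. -/
def IsExpandable (α : ℂ) (ψ : ℂ → ℂ → ℂ) : Prop :=
  ∀ p : ℕ, ∃ (q : ℕ) (e φ : ℕ → ℂ → ℂ), (∀ k, AnalyticAt ℂ (e k) α) ∧ (∀ k, φ k ∈ polarParts) ∧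
    ∀ w, w ≠ 1 → w ≠ -1 → ∃ R, AnalyticAt ℂ R α ∧
      ∀ᶠ z in 𝓝[≠] α, ψ z w = ∑ k ∈ Finset.range q, e k z * φ k w + (z - α) ^ p * R z

theorem IsExpandable.exists_analyticAt {α : ℂ} {ψ : ℂ → ℂ → ℂ} (h : IsExpandable α ψ) {w : ℂ}
    (h1 : w ≠ 1) (h2 : w ≠ -1) : ∃ A, AnalyticAt ℂ A α ∧ ∀ᶠ z in 𝓝[≠] α, ψ z w = A z := by
  obtain ⟨q, e, φ, he, -, h⟩ := h 0
  obtain ⟨R, hR, h⟩ := h w h1 h2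
  refine ⟨_, ?_, h⟩
  have : AnalyticAt ℂ (fun z => ∑ k ∈ Finset.range q, e k z * φ k w) α :=
    Finset.analyticAt_fun_sum _ fun k _ => (he k).mul analyticAt_const
  exact this.add (((analyticAt_id.sub analyticAt_const).pow 0).mul hR)

theorem exists_analyticAt_prod {ι : Type*} (s : Finset ι) {α : ℂ} {ψ : ι → ℂ → ℂ → ℂ}
    (hψ : ∀ i, IsExpandable α (ψ i)) {w : ι → ℂ} (hw : OffBranch w) :
    ∃ A, AnalyticAt ℂ A α ∧ ∀ᶠ z in 𝓝[≠] α, ∏ i ∈ s, ψ i z (w i) = A z := by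
  choose A hA h using fun i => (hψ i).exists_analyticAt (hw i).1 (hw i).2
  refine ⟨fun z => ∏ i ∈ s, A i z, Finset.analyticAt_fun_prod _ fun i _ => hA i, ?_⟩
  have := (eventually_all_finset s).2 fun i _ => h i
  filter_upwards [this] with z hz
  exact Finset.prod_congr rfl hz

theorem meromorphicAt_prod_of_isExpandable {ι : Type*} (s : Finset ι) {α : ℂ} {ψ : ι → ℂ → ℂ → ℂ}
    (hψ : ∀ i, IsExpandable α (ψ i)) {w : ι → ℂ} (hw : OffBranch w) :
    MeromorphicAt (fun z => ∏ i ∈ s, ψ i z (w i)) α := by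
  obtain ⟨A, hA, h⟩ := exists_analyticAt_prod s hψ hw
  exact hA.meromorphicAt.congr (h.mono fun z hz => hz.symm)

theorem residue_mul_prod_mem_polarTensors {ι : Type*} [DecidableEq ι] (s : Finset ι) {α : ℂ}
    {ψ : ι → ℂ → ℂ → ℂ} (hψ : ∀ i, IsExpandable α (ψ i)) {D : ℂ → ℂ} (hD : MeromorphicAt D α) :
    (fun w : ι → ℂ => residue (fun z => D z * ∏ i ∈ s, ψ i z (w i)) α) ∈ polarTensors s := by
  induction s using Finset.induction_on generalizing D with
  | empty =>
    have h1 : (fun _ => 1 : (ι → ℂ) → ℂ) ∈ polarTensors ∅ :=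
      Submodule.subset_span ⟨fun _ => 0, fun _ => polarParts.zero_mem, by simp⟩
    refine polarTensors_congr (Submodule.smul_mem _ (residue D α) h1) fun w _ => ?_
    simp
  | insert a s ha ih =>
    obtain ⟨p, hp⟩ := id hD
    obtain ⟨q, e, φ, he, hφ, hex⟩ := hψ a p
    have hDe : ∀ k, MeromorphicAt (fun z => D z * e k z) α :=
      fun k => hD.mul (he k).meromorphicAt
    have hmem := Submodule.sum_mem (polarTensors (insert a s)) (t := Finset.range q)
      fun k _ => mul_mem_polarTensors ha (hφ k) (ih (hDe k))
    refine polarTensors_congr hmem fun w hw => ?_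
    obtain ⟨R, hR, hex⟩ := hex (w a) (hw a).1 (hw a).2
    obtain ⟨A, hA, hprod⟩ := exists_analyticAt_prod s hψ hw
    have hm : ∀ k, MeromorphicAt (fun z => D z * e k z * ∏ i ∈ s, ψ i z (w i)) α :=
      fun k => (hDe k).mul (meromorphicAt_prod_of_isExpandable s hψ hw)
    have hrem : AnalyticAt ℂ (fun z => (z - α) ^ p * D z * (R z * A z)) α := hp.mul (hR.mul hA)
    have hsplit : ∀ᶠ z in 𝓝[≠] α, D z * ∏ i ∈ insert a s, ψ i z (w i) =
        (∑ k ∈ Finset.range q, φ k (w a) * (D z * e k z * ∏ i ∈ s, ψ i z (w i))) +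
          (z - α) ^ p * D z * (R z * A z) := by
      filter_upwards [hex, hprod] with z h1 h2
      rw [Finset.prod_insert ha, h1, h2, add_mul, mul_add, Finset.sum_mul, Finset.mul_sum]
      congr 1
      · exact Finset.sum_congr rfl fun k _ => by ring
      · ring
    have hm' : ∀ k, MeromorphicAt
        (fun z => φ k (w a) * (D z * e k z * ∏ i ∈ s, ψ i z (w i))) α :=
      fun k => (MeromorphicAt.const _ α).mul (hm k)
    have hzero := residue_eq_zero hrem (Eventually.of_forall fun _ => rfl)
    rw [residue_congr hsplit, residue_add (MeromorphicAt.fun_sum fun k _ => hm' k)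
      hrem.meromorphicAt, hzero, add_zero,
      residue_sum _ fun k _ => hm' k, Finset.sum_apply]
    exact Finset.sum_congr rfl fun k _ => residue_const_mul _ (hm k)

/-! ### Examples of expandable families -/

theorem isExpandable_const {α : ℂ} {φ : ℂ → ℂ} (hφ : φ ∈ polarParts) :
    IsExpandable α (fun _ w => φ w) := by
  intro p
  exact ⟨1, fun _ _ => 1, fun _ => φ, fun _ => analyticAt_const, fun _ => hφ,
    fun w _ _ => ⟨fun _ => 0, analyticAt_const, by simp⟩⟩

theorem one_div_sub_sq_eq {s t : ℂ} (hs : s ≠ 0) (hst : s - t ≠ 0) (p : ℕ) :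
    1 / (t - s) ^ 2 = ∑ k ∈ Finset.range p, (k + 1) * t ^ k * (s ^ (k + 2))⁻¹ +
      t ^ p * (((p + 1) * s - p * t) / (s ^ (p + 1) * (s - t) ^ 2)) := by
  have h : (t - s) ^ 2 = (s - t) ^ 2 := by ring
  rw [h]
  induction p with
  | zero => simp; field_simp
  | succ p ih =>
    rw [ih, Finset.sum_range_succ]
    push_cast
    field_simp
    ring

theorem one_div_sub_eq {s t : ℂ} (hs : s ≠ 0) (hst : s - t ≠ 0) (p : ℕ) :
    1 / (s - t) = 1 / s + ∑ k ∈ Finset.range p, t ^ (k + 1) * (s ^ (k + 2))⁻¹ +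
      t ^ p * (t / (s ^ (p + 1) * (s - t))) := by
  induction p with
  | zero => simp; field_simp; ring
  | succ p ih =>
    rw [ih, Finset.sum_range_succ]
    field_simp
    ring

/-- The local coordinate changes at a branch point: analytic germs fixing `α`. -/
def FixesBranch (α : ℂ) (u : ℂ → ℂ) : Prop :=
  AnalyticAt ℂ u α ∧ u α = α ∧ ∃ v, AnalyticAt ℂ v α ∧ ∀ᶠ z in 𝓝 α, u z - α = (z - α) * v z

theorem fixesBranch_id (α : ℂ) : FixesBranch α (fun z => z) :=
  ⟨analyticAt_id, rfl, fun _ => 1, analyticAt_const, by simp⟩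

theorem branch_ne_zero {α : ℂ} (hα : α = 1 ∨ α = -1) : α ≠ 0 := by
  rcases hα with rfl | rfl <;> norm_num

theorem analyticAt_hat {z : ℂ} (hz : z ≠ 0) : AnalyticAt ℂ hat z := by
  unfold hat
  exact analyticAt_const.div analyticAt_id hz

theorem fixesBranch_hat {α : ℂ} (hα : α = 1 ∨ α = -1) : FixesBranch α hat := by
  have h0 := branch_ne_zero hα
  refine ⟨analyticAt_hat h0, ?_, fun z => -α * hat z, analyticAt_const.mul (analyticAt_hat h0), ?_⟩
  · rcases hα with rfl | rfl <;> norm_num [hat]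
  · filter_upwards [isOpen_ne.mem_nhds h0] with z (hz : z ≠ 0)
    rcases hα with rfl | rfl <;> · simp only [hat]; field_simp; ring

theorem FixesBranch.eventually_ne {α : ℂ} {u : ℂ → ℂ} (hu : FixesBranch α u) {w : ℂ}
    (hw : w ≠ α) : ∀ᶠ z in 𝓝 α, w - α - (u z - α) ≠ 0 := by
  have hc : ContinuousAt (fun z => w - α - (u z - α)) α :=
    (continuousAt_const.sub (hu.1.continuousAt.sub continuousAt_const))
  refine hc.eventually_ne ?_
  rw [hu.2.1]
  simpa [sub_eq_zero] using hw

theorem isExpandable_bergmann {α : ℂ} (hα : α = 1 ∨ α = -1) {u : ℂ → ℂ} (hu : FixesBranch α u) :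
    IsExpandable α (fun z w => bergmann (u z) w) := by
  intro p
  obtain ⟨v, hv, huv⟩ := hu.2.2
  have hu' : AnalyticAt ℂ (fun z => u z - α) α := hu.1.sub analyticAt_const
  refine ⟨p, fun k z => (k + 1) * (u z - α) ^ k, fun k w => ((w - α) ^ (k + 2))⁻¹,
    fun k => analyticAt_const.mul (hu'.pow k), fun k => mem_polarParts hα (by omega),
    fun w h1 h2 => ?_⟩
  have hw : w ≠ α := by rcases hα with rfl | rfl <;> assumption
  have hs : w - α ≠ 0 := sub_ne_zero.2 hw
  refine ⟨fun z => v z ^ p * (((p + 1) * (w - α) - p * (u z - α)) /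
    ((w - α) ^ (p + 1) * (w - α - (u z - α)) ^ 2)), ?_, ?_⟩
  · refine (hv.pow p).mul (AnalyticAt.div (analyticAt_const.sub (analyticAt_const.mul hu'))
      (analyticAt_const.mul ((analyticAt_const.sub hu').pow 2)) ?_)
    exact mul_ne_zero (pow_ne_zero _ hs) (pow_ne_zero _ (hu.eventually_ne hw).self_of_nhds)
  · filter_upwards [mem_nhdsWithin_of_mem_nhds huv,
      mem_nhdsWithin_of_mem_nhds (hu.eventually_ne hw)] with z h3 h4
    have := one_div_sub_sq_eq hs h4 p
    rw [bergmann, show u z - w = u z - α - (w - α) by ring, this]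
    congr 1
    rw [← mul_assoc, ← mul_pow, ← h3]

theorem isExpandable_bergmannIntegral {α : ℂ} (hα : α = 1 ∨ α = -1) :
    IsExpandable α (fun z w => bergmannIntegral w (hat z) z) := by
  intro p
  have hu := fixesBranch_hat hα
  have hi := fixesBranch_id α
  obtain ⟨v, hv, huv⟩ := hu.2.2
  have hu' : AnalyticAt ℂ (fun z => hat z - α) α := hu.1.sub analyticAt_const
  have hi' : AnalyticAt ℂ (fun z => z - α) α := hi.1.sub analyticAt_const
  refine ⟨p, fun k z => (z - α) ^ (k + 1) - (hat z - α) ^ (k + 1),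
    fun k w => ((w - α) ^ (k + 2))⁻¹,
    fun k => (hi'.pow _).sub (hu'.pow _), fun k => mem_polarParts hα (by omega),
    fun w h1 h2 => ?_⟩
  have hw : w ≠ α := by rcases hα with rfl | rfl <;> assumption
  have hs : w - α ≠ 0 := sub_ne_zero.2 hw
  refine ⟨fun z => (z - α) / ((w - α) ^ (p + 1) * (w - α - (z - α))) -
    v z ^ p * ((hat z - α) / ((w - α) ^ (p + 1) * (w - α - (hat z - α)))), ?_, ?_⟩
  · refine (AnalyticAt.div hi' (analyticAt_const.mul (analyticAt_const.sub hi')) ?_).sub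
      ((hv.pow p).mul (AnalyticAt.div hu' (analyticAt_const.mul (analyticAt_const.sub hu')) ?_))
    · exact mul_ne_zero (pow_ne_zero _ hs) (hi.eventually_ne hw).self_of_nhds
    · exact mul_ne_zero (pow_ne_zero _ hs) (hu.eventually_ne hw).self_of_nhds
  · filter_upwards [mem_nhdsWithin_of_mem_nhds huv,
      mem_nhdsWithin_of_mem_nhds (hu.eventually_ne hw),
      mem_nhdsWithin_of_mem_nhds (hi.eventually_ne hw)] with z h3 h4 h5
    rw [bergmannIntegral, show w - z = w - α - (z - α) by ring,
      show w - hat z = w - α - (hat z - α) by ring, one_div_sub_eq hs h4 p, one_div_sub_eq hs h5 p]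
    simp only [sub_mul, Finset.sum_sub_distrib]
    have : (hat z - α) ^ p = (z - α) ^ p * v z ^ p := by rw [← mul_pow, ← h3]
    rw [this]
    ring

/-! ### Families that are products of a meromorphic germ and expandable families -/

/-- The span of the families `D z * ∏ i ∈ s, ψ i z (w i)`, `D` meromorphic at `α` and `ψ i`
expandable at `α`, as germs in `z` in a punctured neighbourhood of `α` for each tuple `w` away from
the branch points. -/
def branchTensors {ι : Type*} (α : ℂ) (s : Finset ι) : Submodule ℂ (ℂ → (ι → ℂ) → ℂ) :=
  Submodule.span ℂ {H | ∃ (D : ℂ → ℂ) (ψ : ι → ℂ → ℂ → ℂ), MeromorphicAt D α ∧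
    (∀ i, IsExpandable α (ψ i)) ∧
    ∀ w, OffBranch w → ∀ᶠ z in 𝓝[≠] α, H z w = D z * ∏ i ∈ s, ψ i z (w i)}

section

variable {ι : Type*} {α : ℂ} {s t : Finset ι}

theorem branchTensors_congr {H K : ℂ → (ι → ℂ) → ℂ} (hH : H ∈ branchTensors α s)
    (h : ∀ w, OffBranch w → ∀ᶠ z in 𝓝[≠] α, K z w = H z w) : K ∈ branchTensors α s := by
  have : K = H + (K - H) := by abel
  rw [this]
  refine add_mem_span_of_forall_add_mem ⟨fun _ _ => 0, fun _ => 0, fun _ _ _ => 0,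
    MeromorphicAt.const 0 α, fun _ => isExpandable_const polarParts.zero_mem, by simp⟩ ?_ hH
  rintro H' ⟨D, ψ, hD, hψ, hH'⟩
  refine ⟨D, ψ, hD, hψ, fun w hw => ?_⟩
  filter_upwards [h w hw, hH' w hw] with z h1 h2
  simp [h1, h2]

theorem branchTensors_mul [DecidableEq ι] (hst : Disjoint s t) {H K : ℂ → (ι → ℂ) → ℂ}
    (hH : H ∈ branchTensors α s) (hK : K ∈ branchTensors α t) :
    (fun z w => H z w * K z w) ∈ branchTensors α (s ∪ t) := by
  have hc : ∀ {F G : ℂ → (ι → ℂ) → ℂ}, F ∈ branchTensors α (s ∪ t) → (∀ z w, G z w = F z w) →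
      G ∈ branchTensors α (s ∪ t) := by
    intro F G hF h
    have : G = F := by ext z w; exact h z w
    rwa [this]
  refine Submodule.span_induction₂ (R := ℂ)
    (p := fun H K _ _ => (fun z w => H z w * K z w) ∈ branchTensors α (s ∪ t))
    ?_ ?_ ?_ ?_ ?_ ?_ ?_ hH hK
  · rintro H K ⟨D, ψ, hD, hψ, hH⟩ ⟨E, χ, hE, hχ, hK⟩
    refine Submodule.subset_span ⟨fun z => D z * E z, fun i => if i ∈ s then ψ i else χ i,
      hD.mul hE, fun i => ?_, fun w hw => ?_⟩
    · beta_reduce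
      split_ifs
      exacts [hψ i, hχ i]
    · filter_upwards [hH w hw, hK w hw] with z h1 h2
      rw [h1, h2, Finset.prod_union hst]
      have e1 : ∏ i ∈ s, (if i ∈ s then ψ i else χ i) z (w i) = ∏ i ∈ s, ψ i z (w i) :=
        Finset.prod_congr rfl fun i hi => by rw [if_pos hi]
      have e2 : ∏ i ∈ t, (if i ∈ s then ψ i else χ i) z (w i) = ∏ i ∈ t, χ i z (w i) :=
        Finset.prod_congr rfl fun i hi => by rw [if_neg (Finset.disjoint_right.1 hst hi)]
      rw [e1, e2]
      ring
  · exact fun K _ => hc (zero_mem _) fun z w => by simp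
  · exact fun K _ => hc (zero_mem _) fun z w => by simp
  · exact fun F G K _ _ _ h1 h2 => hc (add_mem h1 h2) fun z w => by simp [add_mul]
  · exact fun F G K _ _ _ h1 h2 => hc (add_mem h1 h2) fun z w => by simp [mul_add]
  · exact fun c F G _ _ h1 => hc (Submodule.smul_mem _ c h1) fun z w => by simp [mul_assoc]
  · exact fun c F G _ _ h1 => hc (Submodule.smul_mem _ c h1) fun z w => by simp; ring

theorem branchTensors_of_meromorphicAt {D : ℂ → ℂ} (hD : MeromorphicAt D α) :
    (fun z _ => D z) ∈ branchTensors α (∅ : Finset ι) :=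
  Submodule.subset_span ⟨D, fun _ _ _ => 0, hD,
    fun _ => isExpandable_const polarParts.zero_mem, by simp⟩

theorem branchTensors_of_isExpandable {ψ : ℂ → ℂ → ℂ} (hψ : IsExpandable α ψ) (j : ι) :
    (fun z w => ψ z (w j)) ∈ branchTensors α {j} :=
  Submodule.subset_span ⟨fun _ => 1, fun _ => ψ, MeromorphicAt.const 1 α, fun _ => hψ, by simp⟩

theorem branchTensors_meromorphic_mul {D : ℂ → ℂ} (hD : MeromorphicAt D α)
    {H : ℂ → (ι → ℂ) → ℂ} (hH : H ∈ branchTensors α s) :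
    (fun z w => D z * H z w) ∈ branchTensors α s := by
  classical
  simpa using branchTensors_mul (Finset.disjoint_empty_left s)
    (branchTensors_of_meromorphicAt hD) hH

theorem meromorphicAt_of_mem_branchTensors {H : ℂ → (ι → ℂ) → ℂ} (hH : H ∈ branchTensors α s)
    {w : ι → ℂ} (hw : OffBranch w) : MeromorphicAt (fun z => H z w) α := by
  induction hH using Submodule.span_induction with
  | mem H hH =>
    obtain ⟨D, ψ, hD, hψ, h⟩ := hH
    exact (hD.mul (meromorphicAt_prod_of_isExpandable s hψ hw)).congr
      ((h w hw).mono fun z hz => hz.symm)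
  | zero => exact MeromorphicAt.const 0 α
  | add F G _ _ hF hG => exact hF.add hG
  | smul c F _ hF => exact hF.const_smul c

theorem residue_mem_polarTensors {H : ℂ → (ι → ℂ) → ℂ} (hH : H ∈ branchTensors α s) :
    (fun w => residue (fun z => H z w) α) ∈ polarTensors s := by
  classical
  induction hH using Submodule.span_induction with
  | mem H hH =>
    obtain ⟨D, ψ, hD, hψ, h⟩ := hH
    exact polarTensors_congr (residue_mul_prod_mem_polarTensors s hψ hD)
      fun w hw => residue_congr (h w hw)
  | zero =>
    refine polarTensors_congr (zero_mem _) fun w _ => ?_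
    exact residue_eq_zero (analyticAt_const (v := (0 : ℂ))) (by simp)
  | add F G hF hG ihF ihG =>
    exact polarTensors_congr (add_mem ihF ihG) fun w hw => residue_add
      (meromorphicAt_of_mem_branchTensors hF hw) (meromorphicAt_of_mem_branchTensors hG hw)
  | smul c F hF ihF =>
    exact polarTensors_congr (Submodule.smul_mem _ c ihF) fun w hw => residue_const_mul c
      (meromorphicAt_of_mem_branchTensors hF hw)

theorem meromorphicAt_polarPart_comp {φ : ℂ → ℂ} (hφ : φ ∈ polarParts) {u : ℂ → ℂ}
    (hu : MeromorphicAt u α) : MeromorphicAt (fun z => φ (u z)) α := by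
  induction hφ using Submodule.span_induction with
  | mem φ h =>
    obtain ⟨β, -, k, rfl⟩ := h
    exact ((hu.sub (MeromorphicAt.const β α)).pow (k + 2)).inv
  | zero => exact MeromorphicAt.const 0 α
  | add F G _ _ hF hG => exact hF.add hG
  | smul c F _ hF => exact hF.const_smul c

theorem prod_embedding_mem_branchTensors {k : ℕ} (e : Fin k ↪ ι) {φ : Fin k → ℂ → ℂ}
    (hφ : ∀ i, φ i ∈ polarParts) :
    (fun _ w => ∏ i, φ i (w (e i))) ∈ branchTensors α (Finset.univ.map e) := by
  refine Submodule.subset_span ⟨fun _ => 1, fun j _ w => Function.extend e φ 0 j w,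
    MeromorphicAt.const 1 α, fun j => isExpandable_const ?_, fun w hw => ?_⟩
  · by_cases hj : ∃ i, e i = j
    · obtain ⟨i, rfl⟩ := hj
      rw [e.injective.extend_apply]
      exact hφ i
    · rw [Function.extend_apply' _ _ _ hj]
      exact polarParts.zero_mem
  · refine Eventually.of_forall fun z => ?_
    rw [Finset.prod_map, one_mul]
    exact Finset.prod_congr rfl fun i _ => by beta_reduce; rw [e.injective.extend_apply]

theorem polarTensors_cons_mem_branchTensors {k : ℕ} (e : Fin k ↪ ι) {u : ℂ → ℂ}
    (hu : MeromorphicAt u α) (hu' : ∀ᶠ z in 𝓝[≠] α, u z ≠ 1 ∧ u z ≠ -1)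
    {F : (Fin (k + 1) → ℂ) → ℂ} (hF : F ∈ polarTensors Finset.univ) :
    (fun z w => F (Fin.cons (u z) (fun i => w (e i)))) ∈
      branchTensors α (Finset.univ.map e) := by
  induction hF using Submodule.span_induction with
  | mem F hF =>
    obtain ⟨φ, hφ, h⟩ := hF
    refine branchTensors_congr (branchTensors_meromorphic_mul
      (meromorphicAt_polarPart_comp (hφ 0) hu)
      (prod_embedding_mem_branchTensors e fun i => hφ i.succ)) fun w hw => ?_
    filter_upwards [hu'] with z hz
    rw [h _ (Fin.cases hz fun i => hw (e i)), Fin.prod_univ_succ]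
    simp
  | zero => exact zero_mem _
  | add F G _ _ hF hG => exact add_mem hF hG
  | smul c F _ hF => exact Submodule.smul_mem _ c hF

theorem polarTensors_cons_cons_mem_branchTensors {k : ℕ} (e : Fin k ↪ ι) {u v : ℂ → ℂ}
    (hu : MeromorphicAt u α) (hu' : ∀ᶠ z in 𝓝[≠] α, u z ≠ 1 ∧ u z ≠ -1)
    (hv : MeromorphicAt v α) (hv' : ∀ᶠ z in 𝓝[≠] α, v z ≠ 1 ∧ v z ≠ -1)
    {F : (Fin (k + 1 + 1) → ℂ) → ℂ} (hF : F ∈ polarTensors Finset.univ) :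
    (fun z w => F (Fin.cons (u z) (Fin.cons (v z) (fun i => w (e i))))) ∈
      branchTensors α (Finset.univ.map e) := by
  induction hF using Submodule.span_induction with
  | mem F hF =>
    obtain ⟨φ, hφ, h⟩ := hF
    refine branchTensors_congr (branchTensors_meromorphic_mul
      (meromorphicAt_polarPart_comp (hφ 0) hu) (branchTensors_meromorphic_mul
      (meromorphicAt_polarPart_comp (hφ 1) hv)
      (prod_embedding_mem_branchTensors e fun i => hφ i.succ.succ))) fun w hw => ?_
    filter_upwards [hu', hv'] with z hz hz'
    rw [h _ (Fin.cases hz (Fin.cases hz' fun i => hw (e i))), Fin.prod_univ_succ,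
      Fin.prod_univ_succ]
    simp
  | zero => exact zero_mem _
  | add F G _ _ hF hG => exact add_mem hF hG
  | smul c F _ hF => exact Submodule.smul_mem _ c hF

end

/-! ### The structure of the invariants -/

/-- The expression in square brackets in the recursion. -/
def recursionBracket (y : ℂ → ℂ) (g n : ℕ) (z : ℂ) (zS : Fin n → ℂ) : ℂ :=
  (if 0 < g then eoDensity y (g - 1) (n + 1) z (Fin.cons (hat z) zS) else 0) +
    ∑ g₁ : Fin (g + 1), ∑ I : Finset (Fin n),
      if ¬ ((g₁ : ℕ) = 0 ∧ I.card = 0) ∧ ¬ (g - (g₁ : ℕ) = 0 ∧ Iᶜ.card = 0) then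
        eoDensity y g₁ I.card z (fun i => zS (I.orderEmbOfFin rfl i)) *
          eoDensity y (g - g₁) Iᶜ.card (hat z) (fun i => zS (Iᶜ.orderEmbOfFin rfl i))
      else 0

theorem eoDensity_eq (y : ℂ → ℂ) {g n : ℕ} (h : 2 ≤ 2 * g + n) (z₀ : ℂ) (zS : Fin n → ℂ) :
    eoDensity y g n z₀ zS = branchResidue
      (fun z => kernel y z₀ z * recursionBracket y g n z zS * deriv hat z) := by
  rw [eoDensity]
  · rfl
  · rintro _ rfl rfl; omega
  · rintro _ rfl rfl; omega

theorem eoDensity_zero_one (y : ℂ → ℂ) (z₀ : ℂ) (zS : Fin 1 → ℂ) :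
    eoDensity y 0 1 z₀ zS = bergmann z₀ (zS 0) := by
  rw [eoDensity]

/-- `ω^g_{n+1}` is a combination of products of principal parts at the branch points. -/
def IsPolar (y : ℂ → ℂ) (g n : ℕ) : Prop :=
  (fun w : Fin (n + 1) → ℂ => eoDensity y g n (w 0) (Fin.tail w)) ∈ polarTensors Finset.univ

theorem hat_ne {z : ℂ} (h0 : z ≠ 0) (h1 : z ≠ 1) (h2 : z ≠ -1) : hat z ≠ 1 ∧ hat z ≠ -1 := by
  constructor
  · intro h
    rw [hat, div_eq_iff h0, one_mul] at h
    exact h1 h.symm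
  · intro h
    rw [hat, div_eq_iff h0] at h
    exact h2 (by linear_combination h)

theorem eventually_hat_offBranch (α : ℂ) :
    ∀ᶠ z in 𝓝[≠] α, hat z ≠ 1 ∧ hat z ≠ -1 :=
  (eventually_punctured_branch α).mono fun _ ⟨h0, h1, h2⟩ => hat_ne h0 h1 h2

theorem eoDensity_mem_branchTensors {y : ℂ → ℂ} {g k : ℕ} (hst : 2 ≤ 2 * g + k → IsPolar y g k)
    (hgk : ¬ (g = 0 ∧ k = 0)) {ι : Type*} (e : Fin k ↪ ι) {α : ℂ} (hα : α = 1 ∨ α = -1)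
    {u : ℂ → ℂ} (hu : FixesBranch α u) (hu' : ∀ᶠ z in 𝓝[≠] α, u z ≠ 1 ∧ u z ≠ -1) :
    (fun z w => eoDensity y g k (u z) (fun i => w (e i))) ∈
      branchTensors α (Finset.univ.map e) := by
  by_cases h : 2 ≤ 2 * g + k
  · exact polarTensors_cons_mem_branchTensors e hu.1.meromorphicAt hu' (hst h)
  · obtain ⟨rfl, rfl⟩ : g = 0 ∧ k = 1 := by omega
    have := branchTensors_of_isExpandable (isExpandable_bergmann hα hu) (e 0)
    simpa [eoDensity_zero_one] using this

theorem meromorphicAt_bergmann_hat {α : ℂ} (hα : α = 1 ∨ α = -1) :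
    MeromorphicAt (fun z => bergmann z (hat z)) α := by
  have := (analyticAt_hat (branch_ne_zero hα)).meromorphicAt
  exact (MeromorphicAt.const 1 α).div (((MeromorphicAt.id α).sub this).pow 2)

theorem recursionBracket_mem_branchTensors {y : ℂ → ℂ} {g n : ℕ}
    (hst : ∀ g' n', 2 ≤ 2 * g' + n' → 2 * g' + n' < 2 * g + n → IsPolar y g' n')
    {ι : Type*} (e : Fin n ↪ ι) {α : ℂ} (hα : α = 1 ∨ α = -1) :
    (fun z w => recursionBracket y g n z (fun i => w (e i))) ∈
      branchTensors α (Finset.univ.map e) := by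
  classical
  have hid := fixesBranch_id α
  have hid' : ∀ᶠ z in 𝓝[≠] α, z ≠ 1 ∧ z ≠ -1 :=
    (eventually_punctured_branch α).mono fun z hz => hz.2
  have hh := fixesBranch_hat hα
  have hh' := eventually_hat_offBranch α
  have h1 : (fun z w => if 0 < g then
      eoDensity y (g - 1) (n + 1) z (Fin.cons (hat z) (fun i => w (e i))) else 0) ∈
      branchTensors α (Finset.univ.map e) := by
    by_cases hg : 0 < g
    · simp only [hg, if_true]
      by_cases hs : 2 ≤ 2 * (g - 1) + (n + 1)
      · exact polarTensors_cons_cons_mem_branchTensors e hid.1.meromorphicAt hid'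
          hh.1.meromorphicAt hh' (hst (g - 1) (n + 1) hs (by omega))
      · obtain ⟨rfl, rfl⟩ : g = 1 ∧ n = 0 := by omega
        simpa [eoDensity_zero_one] using
          branchTensors_of_meromorphicAt (ι := ι) (meromorphicAt_bergmann_hat hα)
    · simp only [hg, if_false]
      exact zero_mem _
  have h2 : ∀ (g₁ : Fin (g + 1)) (I : Finset (Fin n)), (fun z w =>
      if ¬ ((g₁ : ℕ) = 0 ∧ I.card = 0) ∧ ¬ (g - (g₁ : ℕ) = 0 ∧ Iᶜ.card = 0) then
        eoDensity y g₁ I.card z (fun i => w (e (I.orderEmbOfFin rfl i))) *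
          eoDensity y (g - g₁) Iᶜ.card (hat z) (fun i => w (e (Iᶜ.orderEmbOfFin rfl i)))
      else 0) ∈ branchTensors α (Finset.univ.map e) := by
    intro g₁ I
    by_cases hc : ¬ ((g₁ : ℕ) = 0 ∧ I.card = 0) ∧ ¬ (g - (g₁ : ℕ) = 0 ∧ Iᶜ.card = 0)
    · simp only [hc, not_false_eq_true, and_self, if_true]
      have hcard := Finset.card_add_card_compl I
      rw [Fintype.card_fin] at hcard
      have hlt := g₁.isLt
      have hm : ∀ J : Finset (Fin n), Finset.univ.map
          ((J.orderEmbOfFin rfl).toEmbedding.trans e) = J.map e := by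
        intro J
        rw [← Finset.map_map, Finset.map_orderEmbOfFin_univ]
      have m1 := eoDensity_mem_branchTensors (fun h => hst g₁ I.card h (by omega)) hc.1
        ((I.orderEmbOfFin rfl).toEmbedding.trans e) hα hid hid'
      have m2 := eoDensity_mem_branchTensors (fun h => hst (g - g₁) Iᶜ.card h (by omega)) hc.2
        ((Iᶜ.orderEmbOfFin rfl).toEmbedding.trans e) hα hh hh'
      rw [hm] at m1 m2
      have := branchTensors_mul ((Finset.disjoint_map e).2 disjoint_compl_right) m1 m2
      rw [← Finset.map_union, Finset.union_compl] at this
      exact this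
    · simp only [hc, if_false]
      exact zero_mem _
  have h3 := add_mem h1 (Submodule.sum_mem _ fun g₁ (_ : g₁ ∈ Finset.univ) =>
    Submodule.sum_mem _ fun I (_ : I ∈ Finset.univ) => h2 g₁ I)
  convert h3 using 1
  ext z w
  simp [recursionBracket, Finset.sum_apply]

/-- The part of the recursion kernel that does not depend on `z₀`. -/
def kernelFactor (y : ℂ → ℂ) (z : ℂ) : ℂ :=
  -(2 * (y z - y (hat z)) * deriv curveX z)⁻¹ * deriv hat z

theorem kernel_mul_eq (y : ℂ → ℂ) (z₀ z b : ℂ) :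
    kernel y z₀ z * b * deriv hat z =
      kernelFactor y z * (bergmannIntegral z₀ (hat z) z * b) := by
  simp only [kernel, kernelFactor]
  ring

theorem meromorphicAt_kernelFactor {y : ℂ → ℂ} {α : ℂ} (hα : α = 1 ∨ α = -1)
    (hy : MeromorphicAt y α) : MeromorphicAt (kernelFactor y) α := by
  have h0 := branch_ne_zero hα
  have hh := analyticAt_hat h0
  have hx : AnalyticAt ℂ curveX α := by
    unfold curveX
    exact analyticAt_id.add (analyticAt_const.div analyticAt_id h0)
  have hy' : MeromorphicAt (fun z => y (hat z)) α := by
    obtain ⟨-, hfix, -⟩ := fixesBranch_hat hα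
    refine MeromorphicAt.comp_analyticAt (f := y) (g := hat) ?_ hh
    rwa [hfix]
  exact ((((MeromorphicAt.const 2 α).mul (hy.sub hy')).mul hx.meromorphicAt.deriv).inv.neg).mul
    hh.meromorphicAt.deriv

theorem isPolar {y : ℂ → ℂ} (hy : ∀ α : ℂ, α = 1 ∨ α = -1 → MeromorphicAt y α) (g n : ℕ)
    (h : 2 ≤ 2 * g + n) : IsPolar y g n := by
  induction hN : 2 * g + n using Nat.strong_induction_on generalizing g n with
  | _ N ih =>
  have key : ∀ α : ℂ, α = 1 ∨ α = -1 → (fun w : Fin (n + 1) → ℂ => residue (fun z =>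
      kernelFactor y z * (bergmannIntegral (w 0) (hat z) z *
        recursionBracket y g n z (Fin.tail w))) α) ∈ polarTensors Finset.univ := by
    intro α hα
    refine residue_mem_polarTensors (H := fun z w => kernelFactor y z *
      (bergmannIntegral (w 0) (hat z) z * recursionBracket y g n z (Fin.tail w)))
      (branchTensors_meromorphic_mul (meromorphicAt_kernelFactor hα (hy α hα)) ?_)
    have m1 := branchTensors_of_isExpandable (isExpandable_bergmannIntegral hα) (0 : Fin (n + 1))
    have m2 := recursionBracket_mem_branchTensors (y := y) (g := g)
      (fun g' n' h1 h2 => ih _ (hN ▸ h2) g' n' h1 rfl) (Fin.succEmb n) hα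
    have hd : Disjoint ({0} : Finset (Fin (n + 1))) (Finset.univ.map (Fin.succEmb n)) := by
      simp
    have := branchTensors_mul hd m1 m2
    have hu : ({0} : Finset (Fin (n + 1))) ∪ Finset.univ.map (Fin.succEmb n) = Finset.univ := by
      ext i
      refine Fin.cases ?_ (fun i => ?_) i <;> simp
    rw [hu] at this
    exact this
  refine polarTensors_congr (add_mem (key 1 (.inl rfl)) (key (-1) (.inr rfl))) fun w _ => ?_
  rw [eoDensity_eq y h, branchResidue_eq]
  simp only [kernel_mul_eq]
  rfl

/-! ### Expansions at the origin -/

theorem hasSum_prod_pi {κ : Type*} {k : ℕ} {f : Fin k → κ → ℂ} {a : Fin k → ℂ}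
    (h : ∀ i, HasSum (f i) (a i)) :
    HasSum (fun b : Fin k → κ => ∏ i, f i (b i)) (∏ i, a i) := by
  induction k with
  | zero => simp
  | succ k ih =>
    have ih := ih fun i => h i.succ
    have hs := summable_mul_of_summable_norm (h 0).summable.norm ih.summable.norm
    rw [← (Fin.consEquiv fun _ : Fin (k + 1) => κ).hasSum_iff]
    have := (h 0).mul ih hs
    simpa [Function.comp_def, Fin.consEquiv, Fin.prod_univ_succ] using this

theorem hasSum_pnat_iff {f : ℕ → ℂ} {a : ℂ} :
    HasSum (fun b : ℕ+ => f ((b : ℕ) - 1)) a ↔ HasSum f a := by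
  rw [← Equiv.pnatEquivNat.hasSum_iff]
  rfl

theorem exists_hasSum_of_mem_polarParts {φ : ℂ → ℂ} (hφ : φ ∈ polarParts) :
    ∃ a : ℕ+ → ℂ, ∀ z, ‖z‖ < 1 → HasSum (fun b : ℕ+ => a b * ((b : ℕ) * z ^ ((b : ℕ) - 1))) (φ z) := by
  induction hφ using Submodule.span_induction with
  | mem φ h =>
    obtain ⟨α, hα, k, rfl⟩ := h
    have h0 := branch_ne_zero hα
    refine ⟨fun b => ((-α) ^ (k + 2))⁻¹ * (((b : ℕ) - 1 + (k + 1)).choose (k + 1) *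
      α ^ ((b : ℕ) - 1)) / (b : ℕ), fun z hz => ?_⟩
    have hn : ‖α * z‖ < 1 := by
      rcases hα with rfl | rfl <;> simpa using hz
    have hs := (hasSum_choose_mul_geometric_of_norm_lt_one (k + 1) hn).mul_left
      ((-α) ^ (k + 2))⁻¹
    have he : ((-α) ^ (k + 2))⁻¹ * (1 / (1 - α * z) ^ (k + 1 + 1)) = ((z - α) ^ (k + 2))⁻¹ := by
      have : z - α = -α * (1 - α * z) := by
        rcases hα with rfl | rfl <;> ring
      rw [this, mul_pow, mul_inv, one_div]
    rw [he, ← hasSum_pnat_iff] at hs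
    convert hs using 2 with b
    have hb : ((b : ℕ) : ℂ) ≠ 0 := by simp
    rw [mul_pow]
    field_simp
  | zero => exact ⟨0, fun z _ => by simp⟩
  | add F G _ _ hF hG =>
    obtain ⟨a, ha⟩ := hF
    obtain ⟨b, hb⟩ := hG
    exact ⟨a + b, fun z hz => by simpa [add_mul] using (ha z hz).add (hb z hz)⟩
  | smul c F _ hF =>
    obtain ⟨a, ha⟩ := hF
    exact ⟨c • a, fun z hz => by simpa [mul_assoc] using (ha z hz).mul_left c⟩

theorem exists_hasSum_of_mem_polarTensors {k : ℕ} {F : (Fin k → ℂ) → ℂ}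
    (hF : F ∈ polarTensors Finset.univ) :
    ∃ N : (Fin k → ℕ+) → ℂ, ∀ z : Fin k → ℂ, (∀ i, ‖z i‖ < 1) →
      HasSum (fun b : Fin k → ℕ+ => N b * ∏ i, ((b i : ℕ) : ℂ) * z i ^ ((b i : ℕ) - 1)) (F z) := by
  induction hF using Submodule.span_induction with
  | mem F h =>
    obtain ⟨φ, hφ, h⟩ := h
    choose a ha using fun i => exists_hasSum_of_mem_polarParts (hφ i)
    refine ⟨fun b => ∏ i, a i (b i), fun z hz => ?_⟩
    have hoff : OffBranch z := by
      intro i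
      constructor <;> intro h1 <;> simpa [h1] using hz i
    rw [h z hoff]
    have := hasSum_prod_pi fun i => ha i (z i) (hz i)
    simpa [Finset.prod_mul_distrib] using this
  | zero => exact ⟨0, fun z _ => by simp⟩
  | add F G _ _ hF hG =>
    obtain ⟨a, ha⟩ := hF
    obtain ⟨b, hb⟩ := hG
    exact ⟨a + b, fun z hz => by simpa [add_mul] using (ha z hz).add (hb z hz)⟩
  | smul c F _ hF =>
    obtain ⟨a, ha⟩ := hF
    exact ⟨c • a, fun z hz => by simpa [mul_assoc] using (ha z hz).mul_left c⟩

theorem exists_isExpansion {k : ℕ} {F : (Fin k → ℂ) → ℂ} (hF : F ∈ polarTensors Finset.univ) :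
    ∃ N, IsExpansion F N := by
  obtain ⟨N, hN⟩ := exists_hasSum_of_mem_polarTensors hF
  refine ⟨N, ?_⟩
  filter_upwards [ball_mem_nhds (0 : Fin k → ℂ) one_pos] with z hz
  exact hN z fun i => (norm_le_pi_norm z i).trans_lt (by simpa using hz)

theorem coeff_eq_of_hasSum {c d : ℕ → ℂ} {f : ℂ → ℂ}
    (hc : ∀ᶠ z in 𝓝 (0 : ℂ), HasSum (fun n => c n * z ^ n) (f z))
    (hd : ∀ᶠ z in 𝓝 (0 : ℂ), HasSum (fun n => d n * z ^ n) (f z)) : c = d := by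
  have key : ∀ c : ℕ → ℂ, (∀ᶠ z in 𝓝 (0 : ℂ), HasSum (fun n => c n * z ^ n) (f z)) →
      HasFPowerSeriesAt f (FormalMultilinearSeries.ofScalars ℂ c) 0 := by
    intro c hc
    rw [hasFPowerSeriesAt_iff]
    filter_upwards [hc] with z hz
    simpa [FormalMultilinearSeries.coeff_ofScalars, mul_comm] using hz
  have := (key c hc).eq_formalMultilinearSeries (key d hd)
  ext n
  simpa [FormalMultilinearSeries.coeff_ofScalars] using
    congrArg (fun p : FormalMultilinearSeries ℂ ℂ ℂ => p.coeff n) this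

theorem coeff_eq_of_hasSum_pnat {a : ℕ+ → ℂ} {c : ℕ → ℂ} {f : ℂ → ℂ}
    (ha : ∀ᶠ z in 𝓝 (0 : ℂ), HasSum (fun b : ℕ+ => a b * ((b : ℕ) * z ^ ((b : ℕ) - 1))) (f z))
    (hc : ∀ᶠ z in 𝓝 (0 : ℂ), HasSum (fun n => c n * z ^ n) (f z)) (b : ℕ+) :
    a b * (b : ℕ) = c ((b : ℕ) - 1) := by
  have h : ∀ᶠ z in 𝓝 (0 : ℂ),
      HasSum (fun n => a n.succPNat * ((n + 1 : ℕ) : ℂ) * z ^ n) (f z) := by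
    filter_upwards [ha] with z hz
    rw [← hasSum_pnat_iff]
    convert hz using 2 with b
    have h1 : ((b : ℕ) - 1).succPNat = b := PNat.succPNat_natPred b
    have h2 : (b : ℕ) - 1 + 1 = b := PNat.natPred_add_one b
    rw [h1, h2, mul_assoc]
  have := congrFun (coeff_eq_of_hasSum h hc) ((b : ℕ) - 1)
  have h1 : ((b : ℕ) - 1).succPNat = b := PNat.succPNat_natPred b
  have h2 : (b : ℕ) - 1 + 1 = b := PNat.natPred_add_one b
  rwa [h1, h2] at this

/-- If a series in `q.1` and `q.2` sums to `0` for all small `z`, then so do its slices. -/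
theorem hasSum_zero_of_eventually_hasSum_mul_prod {k : ℕ} {m : (Fin k → ℕ+) → ℕ+ → ℂ}
    (huniq : ∀ N : (Fin k → ℕ+) → ℂ, IsExpansion (fun _ => 0) N → N = 0)
    (h : ∀ᶠ z in 𝓝 (0 : Fin k → ℂ), HasSum (fun q : (Fin k → ℕ+) × ℕ+ =>
      m q.1 q.2 * ∏ i, ((q.1 i : ℕ) : ℂ) * z i ^ ((q.1 i : ℕ) - 1)) 0) (b' : Fin k → ℕ+) :
    HasSum (m b') 0 := by
  have hdiag : Tendsto (fun t : ℂ => fun _ : Fin k => t) (𝓝[≠] 0) (𝓝 0) :=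
    ((continuous_pi fun _ => continuous_id).tendsto (0 : ℂ)).mono_left nhdsWithin_le_nhds
  obtain ⟨t, ht, ht0⟩ := ((hdiag.eventually h).and self_mem_nhdsWithin).exists
  have hsum : ∀ b' : Fin k → ℕ+, Summable (m b') := by
    intro b'
    have hP : ∏ i, ((b' i : ℕ) : ℂ) * t ^ ((b' i : ℕ) - 1) ≠ 0 :=
      Finset.prod_ne_zero_iff.2 fun i _ => mul_ne_zero (by simp) (pow_ne_zero _ ht0)
    have := ht.summable.prod_factor b'
    simp only at this
    exact (summable_mul_right_iff hP).1 this
  have hG : IsExpansion (fun _ => 0) (fun b' => ∑' b : ℕ+, m b' b) := by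
    filter_upwards [h] with z hz
    exact HasSum.prod_fiberwise hz fun b' => HasSum.mul_right
      (∏ i, ((b' i : ℕ) : ℂ) * z i ^ ((b' i : ℕ) - 1)) (hsum b').hasSum
  have h0 : ∑' b : ℕ+, m b' b = 0 := congrFun (huniq _ hG) b'
  exact h0 ▸ (hsum b').hasSum

theorem eq_zero_of_isExpansion_zero {k : ℕ} {N : (Fin k → ℕ+) → ℂ}
    (h : IsExpansion (fun _ => 0) N) : N = 0 := by
  induction k with
  | zero =>
    have := h.self_of_nhds
    ext b
    have h2 := hasSum_single (f := fun b : Fin 0 → ℕ+ =>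
      N b * ∏ i, ((b i : ℕ) : ℂ) * (0 : Fin 0 → ℂ) i ^ ((b i : ℕ) - 1)) b
      fun c hc => absurd (Subsingleton.elim c b) hc
    simpa using h2.unique this
  | succ k ih =>
    have hcont : Tendsto (fun p : ℂ × (Fin k → ℂ) => (Fin.cons p.1 p.2 : Fin (k + 1) → ℂ))
        (𝓝 (0, 0)) (𝓝 0) := by
      have : Continuous fun p : ℂ × (Fin k → ℂ) => (Fin.cons p.1 p.2 : Fin (k + 1) → ℂ) := by
        refine continuous_pi fun i => Fin.cases ?_ (fun i => ?_) i
        · simpa using continuous_fst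
        · simpa [Function.comp_def] using (continuous_apply i).comp continuous_snd
      have h2 := this.tendsto (0, 0)
      have h3 : (Fin.cons (0 : ℂ) (0 : Fin k → ℂ) : Fin (k + 1) → ℂ) = 0 := by
        ext i; refine Fin.cases ?_ (fun i => ?_) i <;> simp
      rwa [h3] at h2
    have h1 := (hcont.eventually h).curry_nhds
    obtain ⟨M, hM⟩ : ∃ M : (Fin k → ℕ+) → ℕ+ → ℂ, ∀ b' b, N (Fin.cons b b') = M b' b :=
      ⟨_, fun _ _ => rfl⟩
    have h2 : ∀ᶠ x in 𝓝 (0 : ℂ), ∀ b' : Fin k → ℕ+, HasSum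
        (fun b : ℕ+ => M b' b * ((b : ℕ) * x ^ ((b : ℕ) - 1))) 0 := by
      filter_upwards [h1] with x hx
      have hx : ∀ᶠ z in 𝓝 (0 : Fin k → ℂ), HasSum (fun q : (Fin k → ℕ+) × ℕ+ =>
          M q.1 q.2 * ((q.2 : ℕ) * x ^ ((q.2 : ℕ) - 1)) *
            ∏ i, ((q.1 i : ℕ) : ℂ) * z i ^ ((q.1 i : ℕ) - 1)) 0 := by
        filter_upwards [hx] with z hz
        rw [← (Fin.consEquiv fun _ : Fin (k + 1) => ℕ+).hasSum_iff,
          ← (Equiv.prodComm _ _).hasSum_iff] at hz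
        simpa [Function.comp_def, Fin.consEquiv, Fin.prod_univ_succ, mul_assoc, hM] using hz
      exact hasSum_zero_of_eventually_hasSum_mul_prod
        (m := fun b' b => M b' b * ((b : ℕ) * x ^ ((b : ℕ) - 1))) (fun _ => ih) hx
    ext b
    have h3 := coeff_eq_of_hasSum_pnat (a := fun c => N (Fin.cons c (Fin.tail b)))
      (c := fun _ => 0) (f := fun _ => 0) (by simpa only [hM] using h2.mono fun x hx => hx (Fin.tail b))
      (Eventually.of_forall fun z => by simp) (b 0)
    simpa [Fin.cons_self_tail] using h3

theorem isExpansion_unique {k : ℕ} {F : (Fin k → ℂ) → ℂ} {N M : (Fin k → ℕ+) → ℂ}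
    (hN : IsExpansion F N) (hM : IsExpansion F M) : N = M := by
  refine sub_eq_zero.1 (eq_zero_of_isExpansion_zero ?_)
  filter_upwards [hN, hM] with z h1 h2
  simpa [sub_mul] using h1.sub h2

/-- Setting all variables but the first to `0` in an expansion. -/
theorem IsExpansion.hasSum_first {n : ℕ} {F : (Fin (n + 1) → ℂ) → ℂ}
    {N : (Fin (n + 1) → ℕ+) → ℂ} (h : IsExpansion F N) :
    ∀ᶠ x in 𝓝 (0 : ℂ), HasSum (fun b : ℕ+ => N (Fin.cons b fun _ => 1) *
      ((b : ℕ) * x ^ ((b : ℕ) - 1))) (F (Fin.cons x fun _ => 0)) := by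
  have hcont : Tendsto (fun x : ℂ => (Fin.cons x fun _ => 0 : Fin (n + 1) → ℂ)) (𝓝 0) (𝓝 0) := by
    have : Continuous fun x : ℂ => (Fin.cons x fun _ => 0 : Fin (n + 1) → ℂ) := by
      refine continuous_pi fun i => Fin.cases ?_ (fun i => ?_) i
      · simpa using continuous_id'
      · simpa using continuous_const
    have h2 := this.tendsto 0
    have h3 : (Fin.cons (0 : ℂ) (fun _ => 0) : Fin (n + 1) → ℂ) = 0 := by
      ext i; refine Fin.cases ?_ (fun i => ?_) i <;> simp
    rwa [h3] at h2
  filter_upwards [hcont.eventually h] with x hx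
  have hinj : Function.Injective (fun b : ℕ+ => (Fin.cons b fun _ => 1 : Fin (n + 1) → ℕ+)) := by
    intro b c hbc
    simpa using congrFun hbc 0
  rw [← hinj.hasSum_iff] at hx
  · simpa [Function.comp_def, Fin.prod_univ_succ] using hx
  · intro b hb
    obtain ⟨i, hi⟩ : ∃ i : Fin n, b i.succ ≠ 1 := by
      by_contra! hcon
      refine hb ⟨b 0, ?_⟩
      ext i
      refine Fin.cases ?_ (fun i => ?_) i <;> simp [hcon]
    have hi' : (b i.succ : ℕ) - 1 ≠ 0 := by
      have := (b i.succ).pos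
      have h3 : (b i.succ : ℕ) ≠ 1 := fun h => hi (PNat.coe_eq_one_iff.1 h)
      omega
    rw [Finset.prod_eq_zero (Finset.mem_univ i.succ), mul_zero]
    simp [hi']

/-! ### The expansion of the recursion at `z₀ = 0` -/

theorem hasSum_circleIntegral {F : ℕ → ℂ → ℂ} {f : ℂ → ℂ} {c : ℂ} {R : ℝ} {u : ℕ → ℝ}
    (hR : 0 < R) (hF : ∀ n, ContinuousOn (F n) (sphere c R)) (hu : Summable u)
    (hb : ∀ n, ∀ z ∈ sphere c R, ‖F n z‖ ≤ u n)
    (h : ∀ z ∈ sphere c R, HasSum (fun n => F n z) (f z)) :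
    HasSum (fun n => ∮ z in C(c, R), F n z) (∮ z in C(c, R), f z) := by
  have hmem : ∀ θ, circleMap c R θ ∈ sphere c R := circleMap_mem_sphere c hR.le
  refine intervalIntegral.hasSum_integral_of_dominated_convergence (fun n _ => R * u n) ?_ ?_ ?_ ?_ ?_
  · intro n
    have hc : Continuous fun θ => F n (circleMap c R θ) :=
      (hF n).comp_continuous (continuous_circleMap c R) hmem
    simp only [deriv_circleMap]
    exact (((continuous_circleMap 0 R).mul continuous_const).smul hc).aestronglyMeasurable
  · intro n
    refine Eventually.of_forall fun θ _ => ?_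
    rw [norm_smul, deriv_circleMap, norm_mul, norm_circleMap_zero, Complex.norm_I, mul_one,
      abs_of_pos hR]
    exact mul_le_mul_of_nonneg_left (hb n _ (hmem θ)) hR.le
  · exact Eventually.of_forall fun θ _ => hu.mul_left R
  · exact intervalIntegrable_const
  · exact Eventually.of_forall fun θ _ => (h _ (hmem θ)).const_smul _

theorem hasSum_bergmannIntegral_hat {x z : ℂ} (hz : z ≠ 0) (h1 : ‖x * z‖ < 1) (h2 : ‖x / z‖ < 1) :
    HasSum (fun k : ℕ => (z ^ (k + 1) - (z ^ (k + 1))⁻¹) * x ^ k)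
      (bergmannIntegral x (hat z) z) := by
  have e1 := (hasSum_geometric_of_norm_lt_one h1).mul_left z
  have e2 := (hasSum_geometric_of_norm_lt_one h2).mul_left z⁻¹
  have n1 : 1 - x * z ≠ 0 := by
    intro h
    rw [← sub_eq_zero.1 h] at h1
    simp at h1
  have n2 : z - x ≠ 0 := by
    intro h
    rw [← sub_eq_zero.1 h, div_self hz] at h2
    simp at h2
  have hf : (fun k : ℕ => (z ^ (k + 1) - (z ^ (k + 1))⁻¹) * x ^ k) =
      fun k => z * (x * z) ^ k - z⁻¹ * (x / z) ^ k := by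
    ext k
    rw [mul_pow, div_pow, pow_succ]
    field_simp
  have ha : bergmannIntegral x (hat z) z =
      z * (1 - x * z)⁻¹ - z⁻¹ * (1 - x / z)⁻¹ := by
    have n3 : x - z ≠ 0 := fun h => n2 (by linear_combination -h)
    have n4 : x * z - 1 ≠ 0 := fun h => n1 (by linear_combination -h)
    have e3 : x - hat z = (x * z - 1) / z := by rw [hat]; field_simp
    have e4 : 1 - x / z = (z - x) / z := by field_simp
    rw [bergmannIntegral, e3, e4, inv_div, one_div_div]
    field_simp
    ring
  rw [hf, ha]
  exact e1.sub e2

theorem hasSum_residue_mul_bergmannIntegral {Q : ℂ → ℂ} {α : ℂ} (hα : α = 1 ∨ α = -1)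
    (hQ : MeromorphicAt Q α) : ∀ᶠ x in 𝓝 (0 : ℂ), HasSum
      (fun k : ℕ => residue (fun z => Q z * (z ^ (k + 1) - (z ^ (k + 1))⁻¹)) α * x ^ k)
      (residue (fun z => Q z * bergmannIntegral x (hat z) z) α) := by
  obtain ⟨R, hR, hR2, hd⟩ := exists_punctured_closedBall hQ.eventually_differentiableAt
    (show (0 : ℝ) < 1 / 2 by norm_num)
  have hα1 : ‖α‖ = 1 := by rcases hα with rfl | rfl <;> simp
  have hlow : ∀ z ∈ closedBall α R, 1 / 2 < ‖z‖ := by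
    intro z hz
    rw [mem_closedBall, dist_eq_norm] at hz
    have := norm_sub_norm_le α z
    rw [norm_sub_rev] at this
    linarith
  have hup : ∀ z ∈ closedBall α R, ‖z‖ < 2 := by
    intro z hz
    rw [mem_closedBall, dist_eq_norm] at hz
    have := norm_sub_norm_le z α
    linarith
  have hne : ∀ z ∈ closedBall α R, z ≠ 0 := by
    intro z hz h
    have := hlow z hz
    rw [h, norm_zero] at this
    linarith
  have hinv : ∀ z ∈ closedBall α R, ‖z⁻¹‖ < 2 := by
    intro z hz
    rw [norm_inv]
    have := inv_strictAnti₀ (by norm_num) (hlow z hz)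
    linarith
  have hQc : ContinuousOn Q (sphere α R) := fun z hz =>
    (hd z (sphere_subset_punctured hR hz)).continuousAt.continuousWithinAt
  obtain ⟨M, hM⟩ := (isCompact_sphere α R).exists_bound_of_continuousOn hQc
  have hM0 : 0 ≤ max M 0 := le_max_right _ _
  filter_upwards [ball_mem_nhds (0 : ℂ) (show (0 : ℝ) < 1 / 4 by norm_num)] with x hx
  rw [mem_ball_zero_iff] at hx
  have hxz : ∀ z ∈ closedBall α R, ‖x * z‖ < 1 := by
    intro z hz
    rw [norm_mul]
    nlinarith [hup z hz, norm_nonneg x, norm_nonneg z]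
  have hxz' : ∀ z ∈ closedBall α R, ‖x / z‖ < 1 := by
    intro z hz
    rw [div_eq_mul_inv, norm_mul]
    nlinarith [hinv z hz, norm_nonneg x, norm_nonneg z⁻¹]
  have hdk : ∀ k : ℕ, ∀ z ∈ closedBall α R \ {α},
      DifferentiableAt ℂ (fun z => Q z * (z ^ (k + 1) - (z ^ (k + 1))⁻¹)) z := by
    intro k z hz
    exact (hd z hz).fun_mul ((differentiableAt_id.pow (k + 1)).fun_sub
      ((differentiableAt_id.pow (k + 1)).fun_inv (pow_ne_zero _ (hne z hz.1))))
  have hdx : ∀ z ∈ closedBall α R \ {α},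
      DifferentiableAt ℂ (fun z => Q z * bergmannIntegral x (hat z) z) z := by
    intro z hz
    have hz0 := hne z hz.1
    have n1 : x - z ≠ 0 := by
      intro h
      have := hxz' z hz.1
      rw [sub_eq_zero.1 h, div_self hz0] at this
      simp at this
    have n2 : x - hat z ≠ 0 := by
      intro h
      have := hxz z hz.1
      rw [sub_eq_zero.1 h, hat, one_div, inv_mul_cancel₀ hz0] at this
      simp at this
    have hh : DifferentiableAt ℂ hat z := (analyticAt_hat hz0).differentiableAt
    unfold bergmannIntegral
    exact (hd z hz).fun_mul (((differentiableAt_const 1).fun_div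
      ((differentiableAt_const x).fun_sub differentiableAt_id) n1).fun_sub
      ((differentiableAt_const 1).fun_div ((differentiableAt_const x).fun_sub hh) n2))
  have key : HasSum (fun k : ℕ => ∮ z in C(α, R), Q z * (z ^ (k + 1) - (z ^ (k + 1))⁻¹) * x ^ k)
      (∮ z in C(α, R), Q z * bergmannIntegral x (hat z) z) := by
    refine hasSum_circleIntegral (u := fun k => max M 0 * 4 * (1 / 2) ^ k) hR ?_ ?_ ?_ ?_
    · intro k z hz
      exact ((hdk k z (sphere_subset_punctured hR hz)).mul_const _).continuousAt.continuousWithinAt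
    · exact (summable_geometric_of_lt_one (by norm_num) (by norm_num)).mul_left _
    · intro k z hz
      have hz' := sphere_subset_closedBall hz
      have b1 : ‖z ^ (k + 1) - (z ^ (k + 1))⁻¹‖ ≤ 2 ^ (k + 1) + 2 ^ (k + 1) := by
        refine (norm_sub_le _ _).trans (add_le_add ?_ ?_)
        · rw [norm_pow]
          exact pow_le_pow_left₀ (norm_nonneg _) (hup z hz').le _
        · rw [← inv_pow, norm_pow]
          exact pow_le_pow_left₀ (norm_nonneg _) (hinv z hz').le _
      have b2 : ‖x ^ k‖ ≤ (1 / 4) ^ k := by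
        rw [norm_pow]
        exact pow_le_pow_left₀ (norm_nonneg _) hx.le _
      rw [norm_mul, norm_mul]
      calc ‖Q z‖ * ‖z ^ (k + 1) - (z ^ (k + 1))⁻¹‖ * ‖x ^ k‖
          ≤ max M 0 * (2 ^ (k + 1) + 2 ^ (k + 1)) * (1 / 4) ^ k := by
            gcongr
            exact (hM z hz).trans (le_max_left _ _)
        _ = max M 0 * 4 * (1 / 2) ^ k := by
            have : (1 / 2 : ℝ) ^ k = 2 ^ k * (1 / 4) ^ k := by rw [← mul_pow]; norm_num
            rw [this]
            ring
    · intro z hz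
      have hz' := sphere_subset_closedBall hz
      simpa only [mul_assoc] using
        (hasSum_bergmannIntegral_hat (hne z hz') (hxz z hz') (hxz' z hz')).mul_left (Q z)
  rw [residue_eq_circleIntegral hR hdx]
  simp only [residue_eq_circleIntegral hR (hdk _)]
  have hc : ∀ k : ℕ, (∮ z in C(α, R), Q z * (z ^ (k + 1) - (z ^ (k + 1))⁻¹) * x ^ k) =
      (∮ z in C(α, R), Q z * (z ^ (k + 1) - (z ^ (k + 1))⁻¹)) * x ^ k := by
    intro k
    simp only [mul_comm _ (x ^ k), circleIntegral.integral_const_mul]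
  simp only [hc] at key
  simpa only [mul_assoc] using key.mul_left (2 * (Real.pi : ℂ) * Complex.I)⁻¹

/-! ### The bracket of the recursion at the origin -/

theorem exists_polarPart_of_mem_polarTensors {k : ℕ} {F : (Fin (k + 1) → ℂ) → ℂ}
    (hF : F ∈ polarTensors Finset.univ) :
    ∃ f ∈ polarParts, ∀ z, z ≠ 1 → z ≠ -1 → F (Fin.cons z fun _ => 0) = f z := by
  induction hF using Submodule.span_induction with
  | mem F h =>
    obtain ⟨φ, hφ, h⟩ := h
    refine ⟨(∏ i : Fin k, φ i.succ 0) • φ 0, polarParts.smul_mem _ (hφ 0), fun z h1 h2 => ?_⟩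
    rw [h _ (Fin.cases ⟨h1, h2⟩ fun i => by simp), Fin.prod_univ_succ]
    simp [mul_comm]
  | zero => exact ⟨0, zero_mem _, fun _ _ _ => rfl⟩
  | add F G _ _ hF hG =>
    obtain ⟨f, hf, hF⟩ := hF
    obtain ⟨g, hg, hG⟩ := hG
    exact ⟨f + g, add_mem hf hg, fun z h1 h2 => by simp [hF z h1 h2, hG z h1 h2]⟩
  | smul c F _ hF =>
    obtain ⟨f, hf, hF⟩ := hF
    exact ⟨c • f, polarParts.smul_mem c hf, fun z h1 h2 => by simp [hF z h1 h2]⟩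

theorem polarTensors_hat_mem_balanced {k : ℕ} {F : (Fin (k + 1 + 1) → ℂ) → ℂ}
    (hF : F ∈ polarTensors Finset.univ) :
    (fun z => F (Fin.cons z (Fin.cons (hat z) fun _ => 0)) * (z ^ 2 - 1)⁻¹) ∈ balanced := by
  induction hF using Submodule.span_induction with
  | mem F h =>
    obtain ⟨φ, hφ, h⟩ := h
    refine balanced_congr (balanced.smul_mem (∏ i : Fin k, φ i.succ.succ 0)
      (mul_hat_div_mem_balanced (polarParts_le_extended (hφ 0))
        (polarParts_le_extended (hφ 1)))) fun z h0 h1 h2 => ?_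
    rw [h _ (Fin.cases ⟨h1, h2⟩ (Fin.cases (hat_ne h0 h1 h2) fun i => by simp)),
      Fin.prod_univ_succ, Fin.prod_univ_succ]
    simp
    ring
  | zero => exact balanced_congr balanced.zero_mem fun z _ _ _ => by simp
  | add F G _ _ hF hG => exact balanced_congr (add_mem hF hG) fun z _ _ _ => by simp [add_mul]
  | smul c F _ hF =>
    exact balanced_congr (balanced.smul_mem c hF) fun z _ _ _ => by simp [mul_assoc]

theorem exists_extendedPolarPart {y : ℂ → ℂ} {g k : ℕ} (hst : 2 ≤ 2 * g + k → IsPolar y g k)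
    (hgk : ¬ (g = 0 ∧ k = 0)) :
    ∃ f ∈ extendedPolarParts, ∀ z, z ≠ 1 → z ≠ -1 → eoDensity y g k z (fun _ => 0) = f z := by
  by_cases h : 2 ≤ 2 * g + k
  · obtain ⟨f, hf, hF⟩ := exists_polarPart_of_mem_polarTensors (hst h)
    exact ⟨f, polarParts_le_extended hf, hF⟩
  · obtain ⟨rfl, rfl⟩ : g = 0 ∧ k = 1 := by omega
    exact ⟨_, Submodule.subset_span (.inr rfl),
      fun z _ _ => by simp [eoDensity_zero_one, bergmann]⟩

theorem recursionBracket_mul_mem_balanced {y : ℂ → ℂ} {g n : ℕ}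
    (hst : ∀ g' n', 2 ≤ 2 * g' + n' → IsPolar y g' n') :
    (fun z => recursionBracket y g n z (fun _ => 0) * (z ^ 2 - 1)⁻¹) ∈ balanced := by
  have h1 : (fun z => (if 0 < g then
      eoDensity y (g - 1) (n + 1) z (Fin.cons (hat z) (fun _ => 0)) else 0) * (z ^ 2 - 1)⁻¹) ∈
      balanced := by
    by_cases hg : 0 < g
    · simp only [hg, if_true]
      by_cases hs : 2 ≤ 2 * (g - 1) + (n + 1)
      · exact polarTensors_hat_mem_balanced (hst (g - 1) (n + 1) hs)
      · obtain ⟨rfl, rfl⟩ : g = 1 ∧ n = 0 := by omega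
        refine balanced_of_eq (l := 2) (a := 3) (b := 3) (by norm_num) fun z h0 h1 h2 => ?_
        have n1 : z - 1 ≠ 0 := sub_ne_zero.2 h1
        have n2 : z + 1 ≠ 0 := fun h => h2 (eq_neg_of_add_eq_zero_left h)
        have e1 : z ^ 2 - 1 = (z - 1) * (z + 1) := by ring
        have e2 : z - 1 / z = (z - 1) * (z + 1) / z := by field_simp; ring
        change eoDensity y 0 1 z (Fin.cons (hat z) fun _ => 0) * _ = _
        simp only [eoDensity_zero_one, Fin.cons_zero, bergmann, hat, branchMonomial, e1, e2]
        field_simp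
    · simp only [hg, if_false]
      exact balanced_congr balanced.zero_mem fun z _ _ _ => by simp
  have h2 : ∀ (g₁ : Fin (g + 1)) (I : Finset (Fin n)), (fun z =>
      (if ¬ ((g₁ : ℕ) = 0 ∧ I.card = 0) ∧ ¬ (g - (g₁ : ℕ) = 0 ∧ Iᶜ.card = 0) then
        eoDensity y g₁ I.card z (fun _ => 0) *
          eoDensity y (g - g₁) Iᶜ.card (hat z) (fun _ => 0)
      else 0) * (z ^ 2 - 1)⁻¹) ∈ balanced := by
    intro g₁ I
    by_cases hc : ¬ ((g₁ : ℕ) = 0 ∧ I.card = 0) ∧ ¬ (g - (g₁ : ℕ) = 0 ∧ Iᶜ.card = 0)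
    · simp only [hc, not_false_eq_true, and_self, if_true]
      obtain ⟨f, hf, hF⟩ := exists_extendedPolarPart (hst g₁ I.card) hc.1
      obtain ⟨f', hf', hF'⟩ := exists_extendedPolarPart (hst (g - g₁) Iᶜ.card) hc.2
      refine balanced_congr (mul_hat_div_mem_balanced hf hf') fun z h0 h1 h2 => ?_
      obtain ⟨h3, h4⟩ := hat_ne h0 h1 h2
      rw [hF z h1 h2, hF' _ h3 h4]
    · simp only [hc, if_false]
      exact balanced_congr balanced.zero_mem fun z _ _ _ => by simp
  refine balanced_congr (add_mem h1 (Submodule.sum_mem _ fun g₁ (_ : g₁ ∈ Finset.univ) =>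
    Submodule.sum_mem _ fun I (_ : I ∈ Finset.univ) => h2 g₁ I)) fun z _ _ _ => ?_
  simp only [recursionBracket, Pi.add_apply, Finset.sum_apply, add_mul, Finset.sum_mul]

/-! ### The curve `y = z ^ m / m` -/

theorem deriv_hat (z : ℂ) : deriv hat z = -(z ^ 2)⁻¹ := by
  have : hat = fun z => z⁻¹ := by ext; simp [hat]
  rw [this, deriv_inv]

theorem deriv_curveX {z : ℂ} (hz : z ≠ 0) : deriv curveX z = 1 - (z ^ 2)⁻¹ := by
  have h1 : HasDerivAt (fun z : ℂ => z + z⁻¹) (1 + -(z ^ 2)⁻¹) z :=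
    (hasDerivAt_id z).fun_add (hasDerivAt_inv hz)
  have : curveX = fun z => z + z⁻¹ := by ext; simp [curveX]
  rw [this, h1.deriv, sub_eq_add_neg]

theorem kernelFactor_monomial_mul {m : ℕ} (hm : m ≠ 0) {z : ℂ} (h0 : z ≠ 0) (h1 : z ≠ 1)
    (h2 : z ≠ -1) (hz : z ^ m - (z ^ m)⁻¹ ≠ 0) :
    kernelFactor (fun z => z ^ m / m) z * (z ^ m - (z ^ m)⁻¹) = m / 2 * (z ^ 2 - 1)⁻¹ := by
  have n1 : z - 1 ≠ 0 := sub_ne_zero.2 h1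
  have n2 : z + 1 ≠ 0 := fun h => h2 (eq_neg_of_add_eq_zero_left h)
  have n3 : z ^ 2 - 1 ≠ 0 := by
    have : z ^ 2 - 1 = (z - 1) * (z + 1) := by ring
    rw [this]
    exact mul_ne_zero n1 n2
  have hm' : (m : ℂ) ≠ 0 := Nat.cast_ne_zero.2 hm
  have e1 : z ^ m / m - hat z ^ m / m = (z ^ m - (z ^ m)⁻¹) / m := by
    rw [hat, one_div, inv_pow]; ring
  have e2 : 1 - (z ^ 2)⁻¹ = (z ^ 2 - 1) / z ^ 2 := by field_simp
  rw [kernelFactor, deriv_curveX h0, deriv_hat, e1, e2]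
  generalize z ^ m - (z ^ m)⁻¹ = d at hz
  field_simp

theorem eventually_pow_sub_inv_ne_zero {m : ℕ} (hm : m ≠ 0) (α : ℂ) :
    ∀ᶠ z in 𝓝[≠] α, z ^ m - (z ^ m)⁻¹ ≠ 0 := by
  have hfin : {z : ℂ | z ^ (2 * m) = 1}.Finite := by
    have hp : (Polynomial.X ^ (2 * m) - Polynomial.C (1 : ℂ)) ≠ 0 :=
      Polynomial.X_pow_sub_C_ne_zero (by omega) 1
    refine (Polynomial.finite_setOfPred_isRoot hp).subset fun z hz => ?_
    simpa [sub_eq_zero] using hz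
  have h1 : ∀ᶠ z in 𝓝[≠] α, z ∉ {z : ℂ | z ^ (2 * m) = 1} := by
    have : ({z : ℂ | z ^ (2 * m) = 1} \ {α})ᶜ ∈ 𝓝 α :=
      (hfin.subset Set.sdiff_subset).isClosed.isOpen_compl.mem_nhds (by simp)
    filter_upwards [mem_nhdsWithin_of_mem_nhds this, self_mem_nhdsWithin] with z hz hz' hmem
    exact hz ⟨hmem, hz'⟩
  filter_upwards [h1, eventually_punctured_branch α] with z hz ⟨h0, _, _⟩ h
  apply hz
  have hz0 : z ^ m ≠ 0 := pow_ne_zero _ h0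
  have := mul_inv_cancel₀ hz0
  rwa [← sub_eq_zero.1 h, ← pow_add, ← two_mul] at this

theorem meromorphicAt_monomial (m : ℕ) (α : ℂ) : MeromorphicAt (fun z : ℂ => z ^ m / m) α := by
  fun_prop

/-- The coefficient of `z₀ ^ (m - 1)` in `ω^g_{n+1}(z₀, 0, …, 0)` vanishes. -/
theorem branchResidue_monomial_coefficient {m g n : ℕ} (hm : m ≠ 0) :
    branchResidue (fun z => kernelFactor (fun z => z ^ m / m) z *
      recursionBracket (fun z => z ^ m / m) g n z (fun _ => 0) * (z ^ m - (z ^ m)⁻¹)) = 0 := by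
  have hbal := balanced.smul_mem ((m : ℂ) / 2) (recursionBracket_mul_mem_balanced (g := g) (n := n)
    (isPolar fun α _ => meromorphicAt_monomial m α))
  refine Eq.trans ?_ (branchResidue_of_mem_balanced hbal)
  rw [branchResidue_eq, branchResidue_eq]
  have key : ∀ α : ℂ, ∀ᶠ z in 𝓝[≠] α, kernelFactor (fun z => z ^ m / m) z *
      recursionBracket (fun z => z ^ m / m) g n z (fun _ => 0) * (z ^ m - (z ^ m)⁻¹) =
      (((m : ℂ) / 2) • fun z => recursionBracket (fun z => z ^ m / m) g n z (fun _ => 0) *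
        (z ^ 2 - 1)⁻¹) z := by
    intro α
    filter_upwards [eventually_punctured_branch α, eventually_pow_sub_inv_ne_zero hm α]
      with z ⟨h0, h1, h2⟩ h3
    have := kernelFactor_monomial_mul hm h0 h1 h2 h3
    rw [mul_right_comm, this]
    simp only [Pi.smul_apply, smul_eq_mul]
    ring
  rw [residue_congr (key 1), residue_congr (key (-1))]

theorem hasSum_eoDensity_first {y : ℂ → ℂ} (hy : ∀ α : ℂ, α = 1 ∨ α = -1 → MeromorphicAt y α)
    {g n : ℕ} (h : 2 ≤ 2 * g + n) : ∀ᶠ x in 𝓝 (0 : ℂ), HasSum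
      (fun k : ℕ => branchResidue (fun z => kernelFactor y z *
        recursionBracket y g n z (fun _ => 0) * (z ^ (k + 1) - (z ^ (k + 1))⁻¹)) * x ^ k)
      (eoDensity y g n x (fun _ => 0)) := by
  have hQ : ∀ α : ℂ, α = 1 ∨ α = -1 → MeromorphicAt
      (fun z => kernelFactor y z * recursionBracket y g n z (fun _ => 0)) α := by
    intro α hα
    refine (meromorphicAt_kernelFactor hα (hy α hα)).mul ?_
    have := recursionBracket_mem_branchTensors (y := y) (g := g)
      (fun g' n' h' _ => isPolar hy g' n' h') (Function.Embedding.refl (Fin n)) hα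
    exact meromorphicAt_of_mem_branchTensors this (w := fun _ => 0) (fun i => by simp)
  filter_upwards [hasSum_residue_mul_bergmannIntegral (.inl rfl) (hQ 1 (.inl rfl)),
    hasSum_residue_mul_bergmannIntegral (.inr rfl) (hQ (-1) (.inr rfl))] with x h1 h2
  have h3 := h1.add h2
  simp only [← add_mul, ← branchResidue_eq] at h3
  rw [eoDensity_eq y h]
  convert h3 using 2
  ext z
  rw [kernel_mul_eq]
  ring

end EynardOrantin

end

theorem mainTheorem7 (m : ℕ+) (g n : ℕ) (hgn : 2 < 2 * g + (n + 1)) :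
    (∃! N : (Fin (n + 1) → ℕ+) → ℂ,
        EynardOrantin.IsN (fun z : ℂ => z ^ (m : ℕ) / (m : ℕ)) g n N) ∧
      ∀ N : (Fin (n + 1) → ℕ+) → ℂ,
        EynardOrantin.IsN (fun z : ℂ => z ^ (m : ℕ) / (m : ℕ)) g n N →
          N (Fin.cons m (fun _ => 1)) = 0 := by
  have hst : 2 ≤ 2 * g + n := by omega
  have hy : ∀ α : ℂ, α = 1 ∨ α = -1 →
      MeromorphicAt (fun z : ℂ => z ^ (m : ℕ) / (m : ℕ)) α :=
    fun α _ => EynardOrantin.meromorphicAt_monomial m α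
  obtain ⟨N, hN⟩ := EynardOrantin.exists_isExpansion (EynardOrantin.isPolar hy g n hst)
  refine ⟨⟨N, hN, fun M hM => EynardOrantin.isExpansion_unique hM hN⟩, fun M hM => ?_⟩
  have h := EynardOrantin.coeff_eq_of_hasSum_pnat (EynardOrantin.IsExpansion.hasSum_first hM)
    (EynardOrantin.hasSum_eoDensity_first hy hst) m
  have hm : (m : ℕ) - 1 + 1 = m := PNat.natPred_add_one m
  rw [hm, EynardOrantin.branchResidue_monomial_coefficient m.ne_zero] at h
  exact (mul_eq_zero.1 h).resolve_right (by simp)
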